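/- **Setting.** Let $S$ be a finite set; in state $i\in S$ the actions are $0,1,\dots,d(i)$. Let $A_{ij}(a)>0$, $\sum_{j}A_{ij}(a)=1$, be the controlled transition probabilities and $c(i,a)$ a real cost. For angles $\alpha=(\alpha_{ip})_{i\in S,\,1\le p\le d(i)}$ let $$\theta_{ia}(\alpha)=\cos^2(\alpha_{i,a+1})\prod_{k=1}^{a}\sin^2(\alpha_{ik})\ (a<d(i)),\qquad \theta_{i,d(i)}(\alpha)=\prod_{k=1}^{d(i)}\sin^2(\alpha_{ik}),$$ and let $P(\alpha)$ be the transition matrix $P_{(i,a),(j,a')}(\alpha)=A_{ij}(a)\,\theta_{ja'}(\alpha)$ on state-action pairs, with unique invariant probability vector $\pi(\alpha)$. Put $C(\alpha)=\sum_{i,a}\pi_{i,a}(\alpha)c(i,a)$. Fix $\alpha$ with all $\alpha_{jq}\in(0,\pi/2)$, and fix $i\in S$ and $1\le p\le d(i)$. Let $Z_k=(X_k,u_k)$, $k\in\mathbb Z$, be the two-sided stationary Markov chain with transition matrix $P(\alpha)$ and marginal $\pi(\alpha)$; $\mathbb E$ and $\mathrm{Cov}$ refer to this stationary law. Let $(Y_k)_{k\in\mathbb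 Z}$ be i.i.d., independent of $Z$, with $\mathbb P(Y_k=a)=\theta_{ia}(\alpha)/\prod_{m=1}^{p}\sin^2(\alpha_{im})$ for $p\le a\le d(i)$. The phantom action is $\tilde u_k=Y_k$ if $p<d(i)$; if $p=d(i)$, it is $\tilde u_k=d(i)$ when $u_k=d(i)-1$, $\tilde u_k=d(i)-1$ when $u_k=d(i)$, and $0$ otherwise. Let $\nu(k)=\min\{m>0: Z_{k+m}=(i,\tilde u_k)\}$ and $$K_{ip}(\alpha,k)=\begin{cases}-\tan(\alpha_{ip})\,\mathbf 1\{Z_k=(i,p-1)\}, & p<d(i),\\ -\cos(\alpha_{ip})\sin(\alpha_{ip})\,\bigl[\mathbf 1\{Z_k=(i,p-1)\}-\mathbf 1\{Z_k=(i,p)\}\bigr], & p=d(i).\end{cases}$$ For a batch size $N\ge1$ and an integer $n$ let $I_n=\{nN+1,\dots,(n+1)N\}$, and let $\widehat\Gamma_n$ be any real function of $(Z_k)_{k\in I_n}$. With $D_n(k)=\mathbf 1\{k+\nu(k)\in I_n\}$ and $\mathcal L=\{k\le nN:\ k+\nu(k)>nN\}$, the fast weak-derivative phantom estimator over the batch is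 $$\widehat{\widehat G}_n(i,p)=\frac2N\Bigl[\sum_{k\in I_n}K_{ip}(\alpha,k)\Bigl(c(i,u_k)-c(i,\tilde u_k)+\sum_{j=k+1}^{\min\{k+\nu(k),(n+1)N\}}c(Z_j)-\nu(k)\widehat\Gamma_nD_n(k)\Bigr)+\sum_{k\in\mathcal L}K_{ip}(\alpha,k)\Bigl(\sum_{j=nN+1}^{\min\{k+\nu(k),(n+1)N\}}c(Z_j)-\nu(k)\widehat\Gamma_nD_n(k)\Bigr)\Bigr].$$ **Theorem.** Almost surely all $\nu(k)$ are finite and $\mathcal L$ is finite; $\widehat{\widehat G}_n(i,p)$ is integrable, and $C$ is differentiable in $\alpha_{ip}$ at $\alpha$. If $\widehat\Gamma_n$ is unbiased under the stationary law, $\mathbb E[\widehat\Gamma_n]=C(\alpha)$, then for every $N\ge 1$ and every $n$ $$\mathbb E\bigl[\widehat{\widehat G}_n(i,p)\bigr]-\frac{\partial C}{\partial\alpha_{ip}}(\alpha)=-\frac2N\sum_{k\in\mathbb Z}\mathrm{Cov}\Bigl(K_{ip}(\alpha,k)\,\nu(k)\,\mathbf 1\{k+\nu(k)\in I_n\},\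 \widehat\Gamma_n\Bigr),$$ the series being absolutely convergent. (The identity is exact: no $o(1/N)$ remainder is needed.) -/

import Mathlib

open MeasureTheory ProbabilityTheory
open scoped BigOperators

namespace PhantomMDP

/-- State-action pairs `(i, a)`: in state `i` the available actions are `0, 1, …, d i`. -/
abbrev StateAction {S : Type*} (d : S → ℕ) : Type _ := (i : S) × Fin (d i + 1)

/-- Control parameters: one angle for every state `i` and every `p = 1, …, d i`.
The index `p : Fin (d i)` stands for the angle number `p + 1` in the usual one-based numbering. -/
abbrev Angles {S : Type*} (d : S → ℕ) : Type _ := (i : S) → Fin (d i) → ℝ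

/-- The spherical coordinate number `a` of a vector of angles `β`, where `a = 0, …, m`:
`cos β_{a+1} * ∏_{k ≤ a} sin β_k` for `a < m`, and `∏_{k ≤ m} sin β_k` for `a = m`. -/
noncomputable def sphericalCoord {m : ℕ} (β : Fin m → ℝ) (a : Fin (m + 1)) : ℝ :=
  (if h : a.val < m then Real.cos (β ⟨a.val, h⟩) else 1) *
    ∏ k : Fin m, if k.val < a.val then Real.sin (β k) else 1

/-- Probability of choosing action `a` in state `i`, in spherical coordinates. -/
noncomputable def actionProb {S : Type*} {d : S → ℕ} (α : Angles d) (i : S)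
    (a : Fin (d i + 1)) : ℝ :=
  sphericalCoord (α i) a ^ 2

/-- `A i a j` is a controlled transition law: for every state-action pair `(i, a)` it is a
probability vector in `j`, all of whose entries are non-zero. -/
structure IsPositiveControlledLaw {S : Type*} [Fintype S] {d : S → ℕ}
    (A : (i : S) → Fin (d i + 1) → S → ℝ) : Prop where
  pos : ∀ i a j, 0 < A i a j
  sum_eq_one : ∀ i a, ∑ j, A i a j = 1

/-- One-step transition probabilities of the state-action chain `Z_n = (X_n, u_n)`. -/
noncomputable def transProb {S : Type*} {d : S → ℕ} (A : (i : S) → Fin (d i + 1) → S → ℝ)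
    (α : Angles d) (z z' : StateAction d) : ℝ :=
  actionProb α z'.1 z'.2 * A z.1 z.2 z'.1

/-- `π` is an invariant probability vector of the transition matrix `P`. -/
structure IsInvariantProb {E : Type*} [Fintype E] (P : E → E → ℝ) (π : E → ℝ) : Prop where
  nonneg : ∀ z, 0 ≤ π z
  sum_eq_one : ∑ z, π z = 1
  invariant : ∀ z', ∑ z, π z * P z z' = π z'

/-- The invariant probability vector of `P` (it exists and is unique for the chains
considered here). -/
noncomputable def invariantProb {E : Type*} [Fintype E] (P : E → E → ℝ) : E → ℝ :=
  Classical.epsilon (IsInvariantProb P)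

/-- The stationary cost `C(α) = ∑_{i,a} π_{i,a}(α) c(i,a)`. -/
noncomputable def stationaryCost {S : Type*} [Fintype S] {d : S → ℕ}
    (A : (i : S) → Fin (d i + 1) → S → ℝ) (c : StateAction d → ℝ) (α : Angles d) : ℝ :=
  ∑ z, invariantProb (transProb A α) z * c z

/-- The stationary cost as a function of the single angle `(i, p)`, the other angles being those
of `α`. -/
noncomputable def costAlong {S : Type*} [Fintype S] [DecidableEq S] {d : S → ℕ}
    (A : (i : S) → Fin (d i + 1) → S → ℝ) (c : StateAction d → ℝ) (α : Angles d)
    (i : S) (p : Fin (d i)) (x : ℝ) : ℝ :=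
  stationaryCost A c (Function.update α i (Function.update (α i) p x))

/-- Law of the phantom action for the angle `(i, p)`: the law of the action in state `i`
conditioned to be at least `p` (in one-based numbering of `p`). -/
noncomputable def phantomLaw {S : Type*} {d : S → ℕ} (α : Angles d) (i : S) (p : Fin (d i))
    (a : Fin (d i + 1)) : ℝ :=
  if p.val + 1 ≤ a.val then
    actionProb α i a / ∏ m : Fin (d i), (if m.val ≤ p.val then Real.sin (α i m) ^ 2 else 1)
  else 0

/-- `Z` is the two-sided stationary state-action chain with parameter `α`, and `Y` is an i.i.d.
sequence of phantom actions for the angle `(i, p)`, independent of `Z`. -/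
structure IsStationaryPhantomSystem {S : Type*} [Fintype S] {d : S → ℕ}
    (A : (i : S) → Fin (d i + 1) → S → ℝ) (α : Angles d) (i : S) (p : Fin (d i))
    {Ω : Type*} [MeasurableSpace Ω] (μ : Measure Ω)
    (Z : ℤ → Ω → StateAction d) (Y : ℤ → Ω → Fin (d i + 1)) : Prop where
  measurable_chain : ∀ k, Measurable (Z k)
  measurable_phantom : ∀ k, Measurable (Y k)
  /-- finite-dimensional laws of a stationary Markov chain -/
  chain_law : ∀ (k : ℤ) (l : ℕ) (z : ℕ → StateAction d),
    μ.real {ω | ∀ t ≤ l, Z (k + (t : ℤ)) ω = z t} =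
      invariantProb (transProb A α) (z 0) *
        ∏ t ∈ Finset.range l, transProb A α (z t) (z (t + 1))
  phantom_law : ∀ (k : ℤ) (a : Fin (d i + 1)),
    μ.real {ω | Y k ω = a} = phantomLaw α i p a
  phantom_indep : iIndepFun Y μ
  chain_indep_phantom : IndepFun (fun ω k => Z k ω) (fun ω k => Y k ω) μ

section Estimator

variable {S : Type*} {d : S → ℕ} {Ω : Type*}

/-- The phantom action started at time `k`: it is `Y k`, except for the last angle of state `i`,
where the actions `d i - 1` and `d i` are exchanged. -/
def phantomAction (i : S) (p : Fin (d i)) (Z : ℤ → Ω → StateAction d)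
    (Y : ℤ → Ω → Fin (d i + 1)) (k : ℤ) (ω : Ω) : Fin (d i + 1) :=
  if p.val + 1 < d i then Y k ω
  else if (Z k ω).2.val = p.val then p.succ
  else if (Z k ω).2.val = p.val + 1 then p.castSucc
  else 0

/-- The hitting time `ν(k) = min {m > 0 : Z_{k+m} = (i, ũ_k)}`. -/
noncomputable def hittingTime (i : S) (p : Fin (d i)) (Z : ℤ → Ω → StateAction d)
    (Y : ℤ → Ω → Fin (d i + 1)) (k : ℤ) (ω : Ω) : ℕ :=
  sInf {m : ℕ | 0 < m ∧ Z (k + (m : ℤ)) ω = ⟨i, phantomAction i p Z Y k ω⟩}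

/-- The weight `K_{ip}(α, k)`, as a function of the value `z` of `Z_k`. -/
noncomputable def weight [DecidableEq S] (α : Angles d) (i : S) (p : Fin (d i))
    (z : StateAction d) : ℝ :=
  if p.val + 1 < d i then
    -Real.tan (α i p) * (if z = ⟨i, p.castSucc⟩ then 1 else 0)
  else
    -(Real.cos (α i p) * Real.sin (α i p)) *
      ((if z = ⟨i, p.castSucc⟩ then 1 else 0) - (if z = ⟨i, p.succ⟩ then 1 else 0))

/-- The batch `I_n = {nN + 1, …, (n + 1)N}`. -/
noncomputable def batch (N : ℕ) (n : ℤ) : Finset ℤ := Finset.Icc (n * N + 1) ((n + 1) * N)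

/-- An estimator of the cost computed from the trajectory observed during batch `n`. -/
def batchCostEstimator {N : ℕ} (Γ : (Fin N → StateAction d) → ℝ) (n : ℤ)
    (Z : ℤ → Ω → StateAction d) (ω : Ω) : ℝ :=
  Γ fun t => Z (n * N + 1 + (t.val : ℤ)) ω

/-- The list of phantoms that are living at time `j`. -/
def livingPhantoms (i : S) (p : Fin (d i)) (Z : ℤ → Ω → StateAction d)
    (Y : ℤ → Ω → Fin (d i + 1)) (j : ℤ) (ω : Ω) : Set ℤ :=
  {k | k ≤ j ∧ j < k + (hittingTime i p Z Y k ω : ℤ)}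

/-- What phantom `k` receives during batch `n` from time `s` on, after its initial contribution:
the costs `c(Z_j)` for `s ≤ j ≤ min (k + ν(k), (n + 1)N)`, minus `ν(k) Γ̂_n` if it dies
in batch `n`. -/
noncomputable def phantomGain (c : StateAction d → ℝ) (i : S) (p : Fin (d i)) {N : ℕ}
    (Γ : (Fin N → StateAction d) → ℝ) (n : ℤ) (Z : ℤ → Ω → StateAction d)
    (Y : ℤ → Ω → Fin (d i + 1)) (k s : ℤ) (ω : Ω) : ℝ :=
  (∑ j ∈ Finset.Icc s (min (k + (hittingTime i p Z Y k ω : ℤ)) ((n + 1) * N)), c (Z j ω)) -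
    hittingTime i p Z Y k ω * batchCostEstimator Γ n Z ω *
      (if k + (hittingTime i p Z Y k ω : ℤ) ∈ batch N n then 1 else 0)

/-- The fast phantom estimator of the partial derivative of the stationary cost with respect to
the angle `(i, p)`, computed over batch `n` of size `N`. In the first sum `c (Z k ω)` is
`c (i, u_k)` whenever the weight is non-zero. -/
noncomputable def fastPhantomEstimator [DecidableEq S] (c : StateAction d → ℝ) (α : Angles d)
    (i : S) (p : Fin (d i)) {N : ℕ} (Γ : (Fin N → StateAction d) → ℝ) (n : ℤ)
    (Z : ℤ → Ω → StateAction d) (Y : ℤ → Ω → Fin (d i + 1)) (ω : Ω) : ℝ :=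
  2 / (N : ℝ) *
    ((∑ k ∈ batch N n, weight α i p (Z k ω) *
        (c (Z k ω) - c ⟨i, phantomAction i p Z Y k ω⟩ +
          phantomGain c i p Γ n Z Y k (k + 1) ω)) +
      ∑' k : livingPhantoms i p Z Y (n * N) ω, weight α i p (Z k ω) *
        phantomGain c i p Γ n Z Y k (n * N + 1) ω)

end Estimator

end PhantomMDP

/-!
If `h` solves the Poisson equation `h - P h = c - C` of the chain, then the derivative of the
stationary cost `C` in one angle is the stationary mean of `2 K (h(Z) - h(target))`, where `K` is
the weight of a phantom and its target is the phantom state. For a fixed state `w`, the mean cost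
collected by the chain on its way from `z` to `w` is `C` times the mean duration plus
`(P h)(z) - (P h)(w)`. By stationarity, the mean cost that all phantoms together collect at one
given time is the mean cost that one phantom collects during its whole life, and the mean of the
total lifetime of the phantoms that die at one given time is the mean lifetime of one phantom. So
the estimator would be unbiased if, in the means of the products of a lifetime and the estimate of
`C`, this estimate could be replaced by its mean `C`. The error made by doing so is the sum of the
covariances.
-/

namespace PhantomMDP

section Series

open Filter Topology

theorem hasSum_succ_mul_sub {u : ℕ → ℝ} {s : ℝ} (hu : HasSum u s)
    (hmu : Summable fun m : ℕ => m * u m) :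
    HasSum (fun m : ℕ => (m + 1) * (u m - u (m + 1))) s := by
  have htele : HasSum (fun m : ℕ => m * u m - (m + 1 : ℕ) * u (m + 1)) 0 := by
    rw [(hmu.sub ((summable_nat_add_iff 1).2 hmu)).hasSum_iff_tendsto_nat]
    simp only [Finset.sum_range_sub' fun m : ℕ => (m : ℝ) * u m]
    simpa using hmu.tendsto_atTop_zero.neg
  rw [← add_zero s]
  exact (hu.add htele).congr_fun fun m => by push_cast; ring

theorem hasSum_int_iff_of_eq_zero {a : ℤ → ℝ} {j : ℤ} (ha : ∀ k, j ≤ k → a k = 0) {s : ℝ} :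
    HasSum a s ↔ HasSum (fun m : ℕ => a (j - (m + 1))) s := by
  refine (Function.Injective.hasSum_iff (g := fun m : ℕ => j - ((m : ℤ) + 1))
    (fun m n hmn => by simp only at hmn; omega) fun k hk => ha k ?_).symm
  by_contra hlt
  exact hk ⟨(j - k - 1).toNat, by simp only; omega⟩

end Series

section StochasticMatrix

open Matrix
open scoped Matrix.Norms.Operator

variable {E : Type*}

/-- The transition matrix of the chain killed when it jumps to `w`. -/
def taboo [DecidableEq E] (P : Matrix E E ℝ) (w : E) : Matrix E E ℝ := P.updateCol w 0

theorem taboo_apply [DecidableEq E] (P : Matrix E E ℝ) (w z y : E) :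
    taboo P w z y = if y = w then 0 else P z y :=
  updateCol_apply

variable [Fintype E]

/-- Stochastic matrices with positive entries: the finite Markov chains which can jump from any
state to any state in one step. -/
structure IsPositiveStochastic (P : Matrix E E ℝ) : Prop where
  pos : ∀ z w, 0 < P z w
  sum_eq_one : ∀ z, ∑ w, P z w = 1

variable {P : Matrix E E ℝ} {π : E → ℝ}

namespace IsInvariantProb

theorem vecMul_eq (hπ : IsInvariantProb P π) : π ᵥ* P = π :=
  funext hπ.invariant

theorem dotProduct_mulVec (hπ : IsInvariantProb P π) (f : E → ℝ) : π ⬝ᵥ P *ᵥ f = π ⬝ᵥ f := by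
  rw [Matrix.dotProduct_mulVec, hπ.vecMul_eq]

theorem abs_dotProduct_le (hπ : IsInvariantProb P π) (f : E → ℝ) : |π ⬝ᵥ f| ≤ ‖f‖ :=
  calc |π ⬝ᵥ f| ≤ ∑ z, |π z * f z| := Finset.abs_sum_le_sum_abs _ _
    _ ≤ ∑ z, π z * ‖f‖ := Finset.sum_le_sum fun z _ => by
      rw [abs_mul, abs_of_nonneg (hπ.nonneg z)]
      exact mul_le_mul_of_nonneg_left (norm_le_pi_norm f z) (hπ.nonneg z)
    _ = ‖f‖ := by rw [← Finset.sum_mul, hπ.sum_eq_one, one_mul]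

theorem dotProduct_const (hπ : IsInvariantProb P π) (r : ℝ) : (π ⬝ᵥ fun _ => r) = r := by
  simp only [dotProduct, ← Finset.sum_mul, hπ.sum_eq_one, one_mul]

end IsInvariantProb

namespace IsPositiveStochastic

theorem mulVec_const (hP : IsPositiveStochastic P) (r : ℝ) :
    (P *ᵥ fun _ => r) = fun _ => r :=
  funext fun z => by simp only [mulVec, dotProduct, ← Finset.sum_mul, hP.sum_eq_one, one_mul]

theorem exists_vecMul_eq_self [Nonempty E] (hP : IsPositiveStochastic P) :
    ∃ v : E → ℝ, v ≠ 0 ∧ v ᵥ* P = v := by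
  classical
  have hdet : (P - 1).det = 0 := by
    refine exists_mulVec_eq_zero_iff.1 ⟨fun _ => 1, Function.const_ne_zero.2 one_ne_zero, ?_⟩
    rw [sub_mulVec, hP.mulVec_const, one_mulVec, sub_self]
  obtain ⟨v, hv0, hv⟩ := exists_vecMul_eq_zero_iff.2 hdet
  exact ⟨v, hv0, by rwa [vecMul_sub, vecMul_one, sub_eq_zero] at hv⟩

-- `|v| ≤ |v| P` holds entrywise, and both sides have the same sum.
theorem abs_vecMul_eq_self (hP : IsPositiveStochastic P) {v : E → ℝ} (hv : v ᵥ* P = v) :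
    |v| ᵥ* P = |v| := by
  have hle : ∀ w ∈ Finset.univ, |v| w ≤ (|v| ᵥ* P) w := fun w _ =>
    calc |v| w = |∑ z, v z * P z w| := congrArg abs (congrFun hv w).symm
      _ ≤ ∑ z, |v z * P z w| := Finset.abs_sum_le_sum_abs _ _
      _ = (|v| ᵥ* P) w := Finset.sum_congr rfl fun z _ => by
        rw [abs_mul, abs_of_pos (hP.pos z w), Pi.abs_apply]
  have hsum : ∑ w, |v| w = ∑ w, (|v| ᵥ* P) w := by
    simp only [vecMul, dotProduct]
    rw [Finset.sum_comm]
    simp only [← Finset.mul_sum, hP.sum_eq_one, mul_one]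
  exact (funext fun w => (Finset.sum_eq_sum_iff_of_le hle).1 hsum w (Finset.mem_univ w)).symm

theorem exists_isInvariantProb [Nonempty E] (hP : IsPositiveStochastic P) :
    ∃ π, IsInvariantProb P π := by
  obtain ⟨v, hv0, hv⟩ := hP.exists_vecMul_eq_self
  have hpos : 0 < ∑ z, |v| z :=
    Finset.sum_pos' (fun _ _ => abs_nonneg _) <| (Function.ne_iff.1 hv0).imp
      fun z hz => ⟨Finset.mem_univ z, abs_pos.2 hz⟩
  refine ⟨(∑ z, |v| z)⁻¹ • |v|, fun z => ?_, ?_, congrFun (?_ : _ ᵥ* P = _)⟩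
  · exact mul_nonneg (inv_nonneg.2 hpos.le) (abs_nonneg _)
  · simp only [Pi.smul_apply, smul_eq_mul, ← Finset.mul_sum, inv_mul_cancel₀ hpos.ne']
  · rw [smul_vecMul, hP.abs_vecMul_eq_self hv]

theorem isInvariantProb_invariantProb [Nonempty E] (hP : IsPositiveStochastic P) :
    IsInvariantProb P (invariantProb P) :=
  Classical.epsilon_spec hP.exists_isInvariantProb

theorem eq_of_mulVec_eq_self (hP : IsPositiveStochastic P) {h : E → ℝ} (hh : P *ᵥ h = h)
    (z w : E) : h z = h w := by
  obtain ⟨m, -, hm⟩ := Finset.exists_max_image Finset.univ h ⟨z, Finset.mem_univ _⟩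
  have hsum : ∑ y, P m y * (h m - h y) = 0 := by
    simp only [mul_sub, Finset.sum_sub_distrib, ← Finset.sum_mul, hP.sum_eq_one, one_mul]
    exact sub_eq_zero.2 (congrFun hh m).symm
  have hmax : ∀ y, h y = h m := fun y => by
    have hterm := (Finset.sum_eq_zero_iff_of_nonneg fun y _ =>
      mul_nonneg (hP.pos m y).le (sub_nonneg.2 (hm y (Finset.mem_univ y)))).1 hsum y
        (Finset.mem_univ y)
    exact (sub_eq_zero.1 ((mul_eq_zero.1 hterm).resolve_left (hP.pos m y).ne')).symm
  rw [hmax z, hmax w]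

-- `1 - P + 1 πᵀ` is injective, since it preserves the mean with respect to `π`.
theorem exists_poisson (hP : IsPositiveStochastic P) (hπ : IsInvariantProb P π) (f : E → ℝ) :
    ∃ h : E → ℝ, h - P *ᵥ h = f - fun _ => π ⬝ᵥ f := by
  classical
  set M : Matrix E E ℝ := 1 - P + vecMulVec (fun _ => 1) π
  have hM : ∀ h, M *ᵥ h = (h - P *ᵥ h) + fun _ => π ⬝ᵥ h := fun h => by
    ext z
    simp [M, add_mulVec, sub_mulVec, vecMulVec_mulVec]
  have hmean : ∀ h, π ⬝ᵥ M *ᵥ h = π ⬝ᵥ h := fun h => by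
    rw [hM, dotProduct_add, dotProduct_sub, hπ.dotProduct_mulVec, sub_self, zero_add,
      hπ.dotProduct_const]
  have hinj : Function.Injective M.mulVec := by
    refine (injective_iff_map_eq_zero M.mulVecLin).2 fun h (h0 : M *ᵥ h = 0) => ?_
    have hm : π ⬝ᵥ h = 0 := by rw [← hmean, h0, dotProduct_zero]
    have hharm : P *ᵥ h = h := by
      have hsub := hM h
      rw [h0, hm, show (fun _ : E => (0 : ℝ)) = 0 from rfl, add_zero] at hsub
      exact (sub_eq_zero.1 hsub.symm).symm
    ext w
    calc h w = π ⬝ᵥ fun _ => h w := (hπ.dotProduct_const (h w)).symm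
      _ = π ⬝ᵥ h := congrArg _ (funext fun z => hP.eq_of_mulVec_eq_self hharm w z)
      _ = 0 := hm
  obtain ⟨h, hh⟩ := mulVec_surjective_iff_isUnit.2 (mulVec_injective_iff_isUnit.1 hinj) f
  exact ⟨h, eq_sub_of_add_eq (by rw [← hh, hmean, hM])⟩

end IsPositiveStochastic

theorem norm_pow_mulVec_le [DecidableEq E] (T : Matrix E E ℝ) (g : E → ℝ) (m : ℕ) :
    ‖T ^ m *ᵥ g‖ ≤ ‖T‖ ^ m * ‖g‖ := by
  induction m with
  | zero => simp
  | succ m ih =>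
    rw [pow_succ', pow_succ', ← mulVec_mulVec, mul_assoc]
    exact (linfty_opNorm_mulVec T _).trans (mul_le_mul_of_nonneg_left ih (norm_nonneg T))

theorem summable_pow_mulVec [DecidableEq E] {T : Matrix E E ℝ} (hT : ‖T‖ < 1) (g : E → ℝ) :
    Summable fun m : ℕ => T ^ m *ᵥ g :=
  .of_norm_bounded ((summable_geometric_of_lt_one (norm_nonneg T) hT).mul_right ‖g‖)
    (norm_pow_mulVec_le T g)

theorem hasSum_pow_mulVec_sub [DecidableEq E] {T : Matrix E E ℝ} (hT : ‖T‖ < 1) (g : E → ℝ) :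
    HasSum (fun m : ℕ => T ^ m *ᵥ (g - T *ᵥ g)) g := by
  have hg := summable_pow_mulVec hT g
  rw [(summable_pow_mulVec hT _).hasSum_iff_tendsto_nat]
  simp only [mulVec_sub, mulVec_mulVec, ← pow_succ, Finset.sum_range_sub', pow_zero, one_mulVec]
  simpa using hg.tendsto_atTop_zero.const_sub g

section Taboo

variable [DecidableEq E]

theorem taboo_mulVec_apply (P : Matrix E E ℝ) (w : E) (g : E → ℝ) (z : E) :
    (taboo P w *ᵥ g) z = ∑ y, P z y * if y = w then 0 else g y := by
  simp only [mulVec, dotProduct, taboo_apply, ite_mul, zero_mul, mul_ite, mul_zero]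

theorem IsPositiveStochastic.norm_taboo_lt_one (hP : IsPositiveStochastic P) (w : E) :
    ‖taboo P w‖ < 1 := by
  rw [linfty_opNorm_def, NNReal.coe_lt_one, Finset.sup_lt_iff zero_lt_one]
  intro z _
  rw [← NNReal.coe_lt_one]
  push_cast
  rw [← hP.sum_eq_one z]
  refine Finset.sum_lt_sum (fun y _ => ?_) ⟨w, Finset.mem_univ w, ?_⟩
  · rw [taboo_apply]
    split_ifs
    · simpa using (hP.pos z y).le
    · exact (Real.norm_of_nonneg (hP.pos z y).le).le
  · simpa [taboo_apply] using hP.pos z w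

/-- If `h` solves the Poisson equation of `f`, the mean sum of `f` along the chain started in `z`,
up to and including the hitting time of `w`, is `(P h) z - (P h) w`. -/
theorem IsPositiveStochastic.hasSum_taboo_pow_mulVec (hP : IsPositiveStochastic P)
    {f h : E → ℝ} (hh : h - P *ᵥ h = f) (w z : E) :
    HasSum (fun m : ℕ => (taboo P w ^ m *ᵥ P *ᵥ f) z) ((P *ᵥ h) z - (P *ᵥ h) w) := by
  set g : E → ℝ := P *ᵥ h - fun _ => (P *ᵥ h) w with hg
  have htaboo : taboo P w *ᵥ g = P *ᵥ g := by
    ext z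
    refine (taboo_mulVec_apply P w g z).trans (Finset.sum_congr rfl fun y _ => ?_)
    split_ifs with hy <;> simp [hg, hy]
  have hPf : P *ᵥ f = g - taboo P w *ᵥ g := by
    rw [htaboo, ← hh, hg, mulVec_sub, mulVec_sub, hP.mulVec_const, sub_sub_sub_cancel_right]
  rw [hPf]
  exact Pi.hasSum.1 (hasSum_pow_mulVec_sub (hP.norm_taboo_lt_one w) g) z

/-- The mean number of steps before the chain started from `z` hits `w`: the entries of
`taboo P w ^ m *ᵥ 1` are the probabilities of not hitting `w` within `m` steps. -/
noncomputable def meanHittingTime (P : Matrix E E ℝ) (w z : E) : ℝ :=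
  ∑' m : ℕ, (taboo P w ^ m *ᵥ 1) z

namespace IsPositiveStochastic

theorem hasSum_meanHittingTime (hP : IsPositiveStochastic P) (w z : E) :
    HasSum (fun m : ℕ => (taboo P w ^ m *ᵥ 1) z) (meanHittingTime P w z) :=
  (Pi.summable.1 (summable_pow_mulVec (hP.norm_taboo_lt_one w) 1) z).hasSum

theorem hasSum_taboo_pow_mulVec_of_poisson (hP : IsPositiveStochastic P) {f h : E → ℝ} {C : ℝ}
    (hh : h - P *ᵥ h = f - fun _ => C) (w z : E) :
    HasSum (fun m : ℕ => (taboo P w ^ m *ᵥ P *ᵥ f) z)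
      (meanHittingTime P w z * C + ((P *ᵥ h) z - (P *ᵥ h) w)) := by
  have hf : f = (C • (1 : E → ℝ)) + (f - fun _ => C) := by
    ext y
    simp
  have hone : P *ᵥ (1 : E → ℝ) = 1 := hP.mulVec_const 1
  refine (((hP.hasSum_meanHittingTime w z).mul_right C).add
    (hP.hasSum_taboo_pow_mulVec hh w z)).congr_fun fun m => ?_
  conv_lhs => rw [hf]
  simp only [mulVec_add, mulVec_smul, hone, Pi.add_apply, Pi.smul_apply, smul_eq_mul, mul_comm]

theorem hasSum_succ_mul_taboo_pow_sub (hP : IsPositiveStochastic P) (w z : E) :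
    HasSum (fun m : ℕ => (m + 1) * ((taboo P w ^ m *ᵥ 1) z - (taboo P w ^ (m + 1) *ᵥ 1) z))
      (meanHittingTime P w z) := by
  set r := ‖taboo P w‖
  have hr : ‖r‖ < 1 := by rw [norm_norm]; exact hP.norm_taboo_lt_one w
  refine hasSum_succ_mul_sub (hP.hasSum_meanHittingTime w z) ?_
  refine .of_norm_bounded ((summable_pow_mul_geometric_of_norm_lt_one 1 hr).mul_right
    ‖(1 : E → ℝ)‖) fun m => ?_
  rw [norm_mul, Real.norm_natCast, pow_one, mul_assoc]
  exact mul_le_mul_of_nonneg_left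
    ((norm_le_pi_norm _ z).trans (norm_pow_mulVec_le _ _ _)) m.cast_nonneg

end IsPositiveStochastic

end Taboo

end StochasticMatrix

section Perturbation

open Filter Matrix Topology

theorem hasDerivAt_mul_of_eq_zero {f g : ℝ → ℝ} {x g' : ℝ} (hf : ContinuousAt f x)
    (hg : HasDerivAt g g' x) (h0 : g x = 0) : HasDerivAt (fun y => f y * g y) (f x * g') x := by
  rw [hasDerivAt_iff_tendsto_slope] at hg ⊢
  refine ((hf.tendsto.mono_left nhdsWithin_le_nhds).mul hg).congr fun y => ?_
  simp only [slope_def_field, h0]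
  ring

variable {E : Type*} [Fintype E]

theorem IsInvariantProb.dotProduct_sub_dotProduct {P Q : Matrix E E ℝ} {π ρ : E → ℝ}
    (hρ : IsInvariantProb Q ρ) {f h : E → ℝ} (hh : h - P *ᵥ h = f - fun _ => π ⬝ᵥ f) :
    ρ ⬝ᵥ f - π ⬝ᵥ f = ρ ⬝ᵥ (Q *ᵥ h - P *ᵥ h) :=
  calc ρ ⬝ᵥ f - π ⬝ᵥ f = ρ ⬝ᵥ (f - fun _ => π ⬝ᵥ f) := by
        rw [dotProduct_sub, hρ.dotProduct_const]
    _ = ρ ⬝ᵥ (Q *ᵥ h - P *ᵥ h) := by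
        rw [← hh, dotProduct_sub, dotProduct_sub, hρ.dotProduct_mulVec]

variable [Nonempty E] {Q : ℝ → Matrix E E ℝ} {x₀ : ℝ}

theorem continuousAt_invariantProb (hQ : ∀ᶠ x in 𝓝 x₀, IsPositiveStochastic (Q x))
    (hcont : ContinuousAt Q x₀) (w : E) : ContinuousAt (fun x => invariantProb (Q x) w) x₀ := by
  classical
  have hP := hQ.self_of_nhds
  obtain ⟨g, hg⟩ := hP.exists_poisson hP.isInvariantProb_invariantProb (Pi.single w (1 : ℝ))
  have hbound : Tendsto (fun x => ‖Q x *ᵥ g - Q x₀ *ᵥ g‖) (𝓝 x₀) (𝓝 0) := by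
    have hmul : ContinuousAt (fun x => Q x *ᵥ g) x₀ :=
      (continuous_id.matrix_mulVec continuous_const).continuousAt.comp hcont
    exact tendsto_iff_norm_sub_tendsto_zero.1 hmul
  rw [ContinuousAt, tendsto_iff_norm_sub_tendsto_zero]
  refine squeeze_zero' (Eventually.of_forall fun _ => norm_nonneg _) ?_ hbound
  filter_upwards [hQ] with x hx
  have hdiff := hx.isInvariantProb_invariantProb.dotProduct_sub_dotProduct hg
  simp only [dotProduct_single_one] at hdiff
  rw [hdiff]
  exact hx.isInvariantProb_invariantProb.abs_dotProduct_le _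

theorem hasDerivAt_invariantProb_dotProduct (hQ : ∀ᶠ x in 𝓝 x₀, IsPositiveStochastic (Q x))
    (hcont : ContinuousAt Q x₀) {f h u : E → ℝ}
    (hh : h - Q x₀ *ᵥ h = f - fun _ => invariantProb (Q x₀) ⬝ᵥ f)
    (hu : ∀ z, HasDerivAt (fun x => (Q x *ᵥ h) z) (u z) x₀) :
    HasDerivAt (fun x => invariantProb (Q x) ⬝ᵥ f) (invariantProb (Q x₀) ⬝ᵥ u) x₀ := by
  have hmain : HasDerivAt (fun x => invariantProb (Q x₀) ⬝ᵥ f +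
      invariantProb (Q x) ⬝ᵥ (Q x *ᵥ h - Q x₀ *ᵥ h)) (invariantProb (Q x₀) ⬝ᵥ u) x₀ :=
    HasDerivAt.const_add _ <| HasDerivAt.fun_sum fun z _ =>
      hasDerivAt_mul_of_eq_zero (continuousAt_invariantProb hQ hcont z)
        ((hu z).sub_const _) (sub_self _)
  refine hmain.congr_of_eventuallyEq ?_
  filter_upwards [hQ] with x hx
  rw [← hx.isInvariantProb_invariantProb.dotProduct_sub_dotProduct hh, add_sub_cancel]

end Perturbation

section SphericalCoordinates

theorem sum_sphericalCoord_sq {m : ℕ} (β : Fin m → ℝ) :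
    ∑ a, sphericalCoord β a ^ 2 = 1 := by
  induction m with
  | zero => simp [sphericalCoord]
  | succ m ih =>
    have hzero : sphericalCoord β 0 = Real.cos (β 0) := by simp [sphericalCoord]
    have hsucc : ∀ a : Fin (m + 1), sphericalCoord β a.succ =
        Real.sin (β 0) * sphericalCoord (fun k => β k.succ) a := fun a => by
      simp only [sphericalCoord, Fin.prod_univ_succ, Fin.val_succ, Fin.val_zero, Nat.succ_pos,
        Nat.add_lt_add_iff_right, if_true, Fin.succ_mk]
      ring
    rw [Fin.sum_univ_succ, hzero]
    simp only [hsucc, mul_pow, ← Finset.mul_sum, ih]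
    rw [mul_one, Real.cos_sq_add_sin_sq]

theorem continuous_sphericalCoord {m : ℕ} (a : Fin (m + 1)) :
    Continuous fun β : Fin m → ℝ => sphericalCoord β a := by
  refine Continuous.mul ?_ (continuous_finsetProd _ fun k _ => ?_) <;> split_ifs <;> fun_prop

theorem sphericalCoord_ne_zero {m : ℕ} {β : Fin m → ℝ}
    (hβ : ∀ k, Real.cos (β k) ≠ 0 ∧ Real.sin (β k) ≠ 0) (a : Fin (m + 1)) :
    sphericalCoord β a ≠ 0 := by
  refine mul_ne_zero ?_ (Finset.prod_ne_zero_iff.2 fun k _ => ?_) <;> split_ifs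
  exacts [(hβ _).1, one_ne_zero, (hβ k).2, one_ne_zero]

variable {m : ℕ} (β : Fin m → ℝ) (p : Fin m)

/-- The product of the sines of the angles that precede `p`. -/
noncomputable def sinProdBefore : ℝ := ∏ k : Fin m, if k.val < p.val then Real.sin (β k) else 1

variable {β} in
theorem sinProdBefore_ne_zero (hβ : ∀ k, Real.sin (β k) ≠ 0) : sinProdBefore β p ≠ 0 := by
  refine Finset.prod_ne_zero_iff.2 fun k _ => ?_
  split_ifs
  exacts [hβ k, one_ne_zero]

theorem sphericalCoord_update_of_lt (x : ℝ) {a : Fin (m + 1)} (ha : a.val < p.val) :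
    sphericalCoord (Function.update β p x) a = sphericalCoord β a := by
  have hne : ∀ k : Fin m, k.val ≤ a.val → Function.update β p x k = β k := fun k hk =>
    Function.update_of_ne (Fin.ne_of_val_ne (hk.trans_lt ha).ne) _ _
  unfold sphericalCoord
  congr 1
  · split_ifs
    exacts [congrArg Real.cos (hne _ le_rfl), rfl]
  · refine Finset.prod_congr rfl fun k _ => ?_
    split_ifs with hk
    exacts [congrArg Real.sin (hne k hk.le), rfl]

theorem sphericalCoord_update_castSucc (x : ℝ) :
    sphericalCoord (Function.update β p x) p.castSucc = Real.cos x * sinProdBefore β p := by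
  unfold sphericalCoord sinProdBefore
  congr 1
  · simp
  · refine Finset.prod_congr rfl fun k _ => ?_
    simp only [Fin.val_castSucc]
    split_ifs with hk
    exacts [by rw [Function.update_of_ne (Fin.ne_of_val_ne hk.ne)], rfl]

theorem exists_sphericalCoord_update_of_gt {a : Fin (m + 1)} (ha : p.val < a.val) :
    ∃ R, ∀ x, sphericalCoord (Function.update β p x) a = Real.sin x * R := by
  refine ⟨(if h : a.val < m then Real.cos (β ⟨a.val, h⟩) else 1) *
    ∏ k ∈ Finset.univ.erase p, if k.val < a.val then Real.sin (β k) else 1, fun x => ?_⟩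
  unfold sphericalCoord
  rw [← Finset.mul_prod_erase _ _ (Finset.mem_univ p), if_pos ha, Function.update_self,
    mul_left_comm]
  congr 2
  · split_ifs with h
    exacts [by rw [Function.update_of_ne (Fin.ne_of_val_ne ha.ne')], rfl]
  · refine Finset.prod_congr rfl fun k hk => ?_
    rw [Function.update_of_ne (Finset.ne_of_mem_erase hk)]

theorem prod_sin_sq_eq : (∏ k : Fin m, if k.val ≤ p.val then Real.sin (β k) ^ 2 else 1) =
    Real.sin (β p) ^ 2 * sinProdBefore β p ^ 2 := by
  unfold sinProdBefore
  rw [← Finset.mul_prod_erase _ _ (Finset.mem_univ p), if_pos le_rfl,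
    ← Finset.mul_prod_erase _ (fun k : Fin m => if k.val < p.val then Real.sin (β k) else 1)
      (Finset.mem_univ p), if_neg (lt_irrefl _), one_mul, ← Finset.prod_pow]
  congr 1
  refine Finset.prod_congr rfl fun k hk => ?_
  have hne : k.val ≠ p.val := Fin.val_ne_of_ne (Finset.ne_of_mem_erase hk)
  simp only [← lt_iff_le_and_ne.trans (and_iff_left hne), ite_pow, one_pow]

end SphericalCoordinates

/-- The mean of `F z y` for independent `z` and `y` with probability vectors `π` and `φ`. -/
def markedMean {E M : Type*} [Fintype E] [Fintype M] (π : E → ℝ) (φ : M → ℝ) (F : E → M → ℝ) :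
    ℝ :=
  ∑ z, ∑ y, π z * φ y * F z y

section MarkedMean

variable {E M : Type*} [Fintype E] [Fintype M] {π : E → ℝ} {φ : M → ℝ}

theorem markedMean_add (F G : E → M → ℝ) :
    (markedMean π φ fun z y => F z y + G z y) = markedMean π φ F + markedMean π φ G := by
  simp only [markedMean, mul_add, Finset.sum_add_distrib]

theorem markedMean_sub (F G : E → M → ℝ) :
    (markedMean π φ fun z y => F z y - G z y) = markedMean π φ F - markedMean π φ G := by
  simp only [markedMean, mul_sub, Finset.sum_sub_distrib]

theorem markedMean_const_mul (a : ℝ) (F : E → M → ℝ) :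
    (markedMean π φ fun z y => a * F z y) = a * markedMean π φ F := by
  simp only [markedMean, mul_left_comm _ a, Finset.mul_sum]

theorem hasSum_markedMean {F : ℕ → E → M → ℝ} {s : E → M → ℝ}
    (hF : ∀ z y, HasSum (fun m => F m z y) (s z y)) :
    HasSum (fun m => markedMean π φ (F m)) (markedMean π φ s) :=
  hasSum_sum fun z _ => hasSum_sum fun y _ => (hF z y).mul_left _

end MarkedMean

section PhantomDerivative

open Filter Matrix Topology

variable {S : Type*} {d : S → ℕ} {α : Angles d}

theorem sum_actionProb (α : Angles d) (i : S) : ∑ a, actionProb α i a = 1 :=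
  sum_sphericalCoord_sq _

theorem actionProb_pos {i : S} (hα : ∀ q, Real.cos (α i q) ≠ 0 ∧ Real.sin (α i q) ≠ 0)
    (a : Fin (d i + 1)) : 0 < actionProb α i a :=
  sq_pos_of_ne_zero (sphericalCoord_ne_zero hα a)

theorem actionProb_castSucc (i : S) (p : Fin (d i)) :
    actionProb α i p.castSucc = Real.cos (α i p) ^ 2 * sinProdBefore (α i) p ^ 2 := by
  rw [actionProb, ← mul_pow, ← sphericalCoord_update_castSucc, Function.update_eq_self]

theorem phantomLaw_of_le {i : S} {p : Fin (d i)} {a : Fin (d i + 1)} (ha : a.val ≤ p.val) :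
    phantomLaw α i p a = 0 :=
  if_neg (by omega)

theorem phantomLaw_of_lt {i : S} {p : Fin (d i)} {a : Fin (d i + 1)} (ha : p.val < a.val) :
    phantomLaw α i p a = actionProb α i a / (Real.sin (α i p) ^ 2 * sinProdBefore (α i) p ^ 2) := by
  rw [phantomLaw, if_pos (by omega), prod_sin_sq_eq]

theorem phantomLaw_eq_sphericalCoord_sq {i : S} (hα : ∀ q, Real.sin (α i q) ≠ 0) (p : Fin (d i))
    (a : Fin (d i + 1)) :
    phantomLaw α i p a =
      sphericalCoord (fun q => if q.val ≤ p.val then Real.pi / 2 else α i q) a ^ 2 := by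
  rcases le_or_gt a.val p.val with hap | hpa
  · rw [phantomLaw_of_le hap, sphericalCoord, dif_pos (hap.trans_lt p.isLt), if_pos hap,
      Real.cos_pi_div_two, zero_mul, zero_pow two_ne_zero]
  · have hsin : (∏ q : Fin (d i), if q.val ≤ p.val then Real.sin (α i q) ^ 2 else 1) ≠ 0 :=
      Finset.prod_ne_zero_iff.2 fun q _ => by
        split_ifs
        exacts [pow_ne_zero 2 (hα q), one_ne_zero]
    rw [phantomLaw, if_pos (by omega), div_eq_iff hsin, actionProb, sphericalCoord,
      sphericalCoord, mul_pow, mul_pow, ← Finset.prod_pow, ← Finset.prod_pow, mul_assoc,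
      ← Finset.prod_mul_distrib]
    simp only [hpa.not_ge, if_false]
    refine congrArg _ (Finset.prod_congr rfl fun q _ => ?_)
    split_ifs <;> first | omega | simp

theorem sum_phantomLaw {i : S} (hα : ∀ q, Real.sin (α i q) ≠ 0) (p : Fin (d i)) :
    ∑ a, phantomLaw α i p a = 1 := by
  simp only [phantomLaw_eq_sphericalCoord_sq hα, sum_sphericalCoord_sq]

theorem phantomLaw_of_last {i : S} (hα : ∀ q, Real.sin (α i q) ≠ 0) {p : Fin (d i)}
    (hp : ¬ p.val + 1 < d i) (a : Fin (d i + 1)) :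
    phantomLaw α i p a = if a = p.succ then 1 else 0 := by
  have hne : ∀ a, a ≠ p.succ → phantomLaw α i p a = 0 := fun a ha => by
    refine phantomLaw_of_le (not_lt.1 fun hlt => ha (Fin.ext ?_))
    simp only [Fin.val_succ]
    omega
  split_ifs with ha
  · rw [ha, ← sum_phantomLaw hα p, Finset.sum_eq_single p.succ (fun a _ => hne a) (by simp)]
  · exact hne a ha

theorem hasDerivAt_actionProb [DecidableEq S] {i : S}
    (hα : ∀ q, Real.cos (α i q) ≠ 0 ∧ Real.sin (α i q) ≠ 0) (p : Fin (d i))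
    (a : Fin (d i + 1)) :
    HasDerivAt (fun x => actionProb (Function.update α i (Function.update (α i) p x)) i a)
      (2 * Real.tan (α i p) * actionProb α i p.castSucc *
        (phantomLaw α i p a - if a = p.castSucc then 1 else 0)) (α i p) := by
  obtain ⟨hc, hs⟩ := hα p
  have hB := sinProdBefore_ne_zero p fun q => (hα q).2
  rw [actionProb_castSucc, Real.tan_eq_sin_div_cos]
  simp only [actionProb, Function.update_self]
  rcases lt_trichotomy a.val p.val with ha | ha | ha
  · simp only [sphericalCoord_update_of_lt _ _ _ ha]
    refine (hasDerivAt_const (α i p) (sphericalCoord (α i) a ^ 2)).congr_deriv ?_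
    rw [phantomLaw_of_le ha.le, if_neg (Fin.ne_of_val_ne ha.ne), sub_zero, mul_zero]
  · obtain rfl : a = p.castSucc := Fin.ext ha
    simp only [sphericalCoord_update_castSucc]
    refine (((Real.hasDerivAt_cos (α i p)).mul_const
      (sinProdBefore (α i) p)).fun_pow 2).congr_deriv ?_
    rw [phantomLaw_of_le ha.le, if_pos trivial]
    field_simp
    norm_num
    ring
  · obtain ⟨R, hR⟩ := exists_sphericalCoord_update_of_gt (α i) p ha
    have hRa : actionProb α i a = (Real.sin (α i p) * R) ^ 2 := by
      rw [actionProb, ← hR, Function.update_eq_self]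
    simp only [hR]
    refine (((Real.hasDerivAt_sin (α i p)).mul_const R).fun_pow 2).congr_deriv ?_
    rw [phantomLaw_of_lt ha, if_neg (Fin.ne_of_val_ne ha.ne'), hRa]
    field_simp
    norm_num
    ring

theorem continuous_actionProb (i : S) (a : Fin (d i + 1)) :
    Continuous fun α : Angles d => actionProb α i a :=
  ((continuous_sphericalCoord a).comp (continuous_apply i)).pow 2

variable [Fintype S] {A : (i : S) → Fin (d i + 1) → S → ℝ}

theorem IsPositiveControlledLaw.isPositiveStochastic (hA : IsPositiveControlledLaw A)
    (hα : ∀ j q, Real.cos (α j q) ≠ 0 ∧ Real.sin (α j q) ≠ 0) :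
    IsPositiveStochastic (transProb A α) where
  pos z w := mul_pos (actionProb_pos (hα w.1) w.2) (hA.pos _ _ _)
  sum_eq_one z := by
    rw [Fintype.sum_sigma]
    simp only [transProb, ← Finset.sum_mul, sum_actionProb, one_mul, hA.sum_eq_one]

theorem transProb_mulVec (h : StateAction d → ℝ) (z : StateAction d) :
    ((transProb A α : Matrix _ _ ℝ) *ᵥ h) z =
      ∑ j, A z.1 z.2 j * ∑ a, actionProb α j a * h ⟨j, a⟩ := by
  simp only [mulVec, dotProduct, Fintype.sum_sigma, transProb, Finset.mul_sum]
  exact Finset.sum_congr rfl fun j _ => Finset.sum_congr rfl fun a _ => by ring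

theorem IsInvariantProb.eq_actionProb_mul {π : StateAction d → ℝ}
    (hπ : IsInvariantProb (transProb A α) π) (i : S) (a : Fin (d i + 1)) :
    π ⟨i, a⟩ = actionProb α i a * ∑ z, π z * A z.1 z.2 i := by
  rw [← hπ.invariant ⟨i, a⟩, Finset.mul_sum]
  exact Finset.sum_congr rfl fun z _ => by simp only [transProb]; ring

theorem hasDerivAt_transProb_mulVec [DecidableEq S] {i : S}
    (hα : ∀ q, Real.cos (α i q) ≠ 0 ∧ Real.sin (α i q) ≠ 0) (p : Fin (d i))
    (h : StateAction d → ℝ) (z : StateAction d) :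
    HasDerivAt (fun x => ((transProb A
        (Function.update α i (Function.update (α i) p x)) : Matrix _ _ ℝ) *ᵥ h) z)
      (A z.1 z.2 i * (2 * Real.tan (α i p) * actionProb α i p.castSucc *
        (∑ a, phantomLaw α i p a * h ⟨i, a⟩ - h ⟨i, p.castSucc⟩))) (α i p) := by
  have hstate : ∀ j, HasDerivAt (fun x => A z.1 z.2 j * ∑ a,
      actionProb (Function.update α i (Function.update (α i) p x)) j a * h ⟨j, a⟩)
      (if j = i then A z.1 z.2 i * (2 * Real.tan (α i p) * actionProb α i p.castSucc *
        (∑ a, phantomLaw α i p a * h ⟨i, a⟩ - h ⟨i, p.castSucc⟩)) else 0) (α i p) := fun j => by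
    split_ifs with hj
    · subst hj
      refine ((HasDerivAt.fun_sum fun a _ =>
        (hasDerivAt_actionProb hα p a).mul_const _).const_mul _).congr_deriv ?_
      simp only [mul_assoc, ← Finset.mul_sum, sub_mul, Finset.sum_sub_distrib, ite_mul, one_mul,
        zero_mul, Finset.sum_ite_eq', Finset.mem_univ, if_true]
    · simp only [actionProb, Function.update_of_ne hj]
      exact hasDerivAt_const _ _
  simp only [transProb_mulVec]
  refine (HasDerivAt.fun_sum fun j _ => hstate j).congr_deriv ?_
  rw [Finset.sum_ite_eq', if_pos (Finset.mem_univ i)]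

theorem hasDerivAt_costAlong [DecidableEq S] (hA : IsPositiveControlledLaw A)
    (hα : ∀ j q, Real.cos (α j q) ≠ 0 ∧ Real.sin (α j q) ≠ 0) {c h : StateAction d → ℝ}
    (hh : h - (transProb A α : Matrix _ _ ℝ) *ᵥ h = c - fun _ => stationaryCost A c α)
    (i : S) (p : Fin (d i)) :
    HasDerivAt (costAlong A c α i p)
      (2 * Real.tan (α i p) * invariantProb (transProb A α) ⟨i, p.castSucc⟩ *
        (∑ a, phantomLaw α i p a * h ⟨i, a⟩ - h ⟨i, p.castSucc⟩)) (α i p) := by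
  have : Nonempty (StateAction d) := ⟨⟨i, 0⟩⟩
  set upd : ℝ → Angles d := fun x => Function.update α i (Function.update (α i) p x) with hupd
  have hupd_self : upd (α i p) = α := by simp only [hupd, Function.update_eq_self]
  have hpos : ∀ᶠ x in 𝓝 (α i p), IsPositiveStochastic (transProb A (upd x)) := by
    filter_upwards [Real.continuous_cos.continuousAt.eventually_ne (hα i p).1,
      Real.continuous_sin.continuousAt.eventually_ne (hα i p).2] with x hcos hsin
    refine hA.isPositiveStochastic fun j => ?_
    rcases eq_or_ne j i with rfl | hj
    · simp only [hupd, Function.update_self]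
      exact (Function.forall_update_iff _ fun _ y => Real.cos y ≠ 0 ∧ Real.sin y ≠ 0).2
        ⟨⟨hcos, hsin⟩, fun q _ => hα j q⟩
    · simp only [hupd, Function.update_of_ne hj]
      exact hα j
  have hcont : Continuous fun x => (transProb A (upd x) : Matrix _ _ ℝ) := by
    have hupd_cont : Continuous upd :=
      continuous_const.update i (continuous_const.update p continuous_id)
    exact continuous_matrix fun z w =>
      ((continuous_actionProb w.1 w.2).comp hupd_cont).mul continuous_const
  rw [← hupd_self] at hh
  refine (hasDerivAt_invariantProb_dotProduct hpos hcont.continuousAt hh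
    (hasDerivAt_transProb_mulVec (hα i) p h)).congr_deriv ?_
  rw [hupd_self]
  have hinv := (hA.isPositiveStochastic hα).isInvariantProb_invariantProb
  simp only [hinv.eq_actionProb_mul i, dotProduct, ← mul_assoc, ← Finset.sum_mul]
  ring

/-- The state reached by a phantom that starts from `z` with mark `y`. -/
def phantomTarget (i : S) (p : Fin (d i)) (z : StateAction d) (y : Fin (d i + 1)) :
    StateAction d :=
  ⟨i, if p.val + 1 < d i then y
    else if z.2.val = p.val then p.succ
    else if z.2.val = p.val + 1 then p.castSucc
    else 0⟩

theorem markedMean_weight_of_lt [DecidableEq S] {i : S} (hα : ∀ q, Real.sin (α i q) ≠ 0)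
    {p : Fin (d i)} (hp : p.val + 1 < d i) (π h : StateAction d → ℝ) :
    (markedMean π (phantomLaw α i p) fun z y =>
        weight α i p z * (h z - h (phantomTarget i p z y))) =
      Real.tan (α i p) * π ⟨i, p.castSucc⟩ *
        (∑ a, phantomLaw α i p a * h ⟨i, a⟩ - h ⟨i, p.castSucc⟩) := by
  simp only [markedMean, weight, phantomTarget, if_pos hp]
  rw [Finset.sum_eq_single ⟨i, p.castSucc⟩ (fun z _ hz => by simp [hz]) (by simp)]
  simp only [if_true, mul_one]
  calc _ = ∑ y, Real.tan (α i p) * π ⟨i, p.castSucc⟩ *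
        (phantomLaw α i p y * h ⟨i, y⟩ - phantomLaw α i p y * h ⟨i, p.castSucc⟩) :=
        Finset.sum_congr rfl fun y _ => by ring
    _ = _ := by
        rw [← Finset.mul_sum, Finset.sum_sub_distrib, ← Finset.sum_mul, sum_phantomLaw hα,
          one_mul]

-- The weights of the two exchanged actions are opposite, and their probabilities are
-- proportional to `cos ^ 2` and `sin ^ 2`.
theorem markedMean_weight_of_last [DecidableEq S] {i : S}
    (hα : ∀ q, Real.cos (α i q) ≠ 0 ∧ Real.sin (α i q) ≠ 0) {p : Fin (d i)}
    (hp : ¬ p.val + 1 < d i) {π : StateAction d → ℝ}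
    (hπ : IsInvariantProb (transProb A α) π) (h : StateAction d → ℝ) :
    (markedMean π (phantomLaw α i p) fun z y =>
        weight α i p z * (h z - h (phantomTarget i p z y))) =
      Real.tan (α i p) * π ⟨i, p.castSucc⟩ *
        (∑ a, phantomLaw α i p a * h ⟨i, a⟩ - h ⟨i, p.castSucc⟩) := by
  have hne : (⟨i, p.castSucc⟩ : StateAction d) ≠ ⟨i, p.succ⟩ := fun h =>
    p.castSucc_lt_succ.ne (eq_of_heq (Sigma.mk.inj h).2)
  obtain ⟨hc, hs⟩ := hα p
  have hsin := fun q => (hα q).2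
  have hB := sinProdBefore_ne_zero p hsin
  have hsucc : actionProb α i p.succ = Real.sin (α i p) ^ 2 * sinProdBefore (α i) p ^ 2 := by
    have hone := (phantomLaw_of_lt (Fin.val_succ p ▸ p.val.lt_succ_self)).symm.trans
      (phantomLaw_of_last hsin hp p.succ)
    rw [if_pos rfl] at hone
    exact eq_of_div_eq_one hone
  simp only [markedMean, phantomLaw_of_last hsin hp, mul_ite, mul_one, mul_zero, ite_mul, zero_mul,
    one_mul, Finset.sum_ite_eq', Finset.mem_univ, if_true]
  rw [← Finset.sum_subset (Finset.subset_univ {⟨i, p.castSucc⟩, ⟨i, p.succ⟩}),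
    Finset.sum_pair hne]
  · simp only [weight, phantomTarget, if_neg hp, if_neg hne, if_neg hne.symm, if_true,
      Fin.val_castSucc, Fin.val_succ, Nat.succ_ne_self, if_false]
    rw [hπ.eq_actionProb_mul, hπ.eq_actionProb_mul, hsucc, actionProb_castSucc,
      Real.tan_eq_sin_div_cos]
    field_simp
    linear_combination (∑ z, π z * A z.1 z.2 i) * (h ⟨i, p.succ⟩ - h ⟨i, p.castSucc⟩) *
      Real.sin_sq_add_cos_sq (α i p)
  · intro z _ hz
    simp only [Finset.mem_insert, Finset.mem_singleton, not_or] at hz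
    simp [weight, hp, hz.1, hz.2]

theorem hasDerivAt_costAlong_markedMean [DecidableEq S] (hA : IsPositiveControlledLaw A)
    (hα : ∀ j q, Real.cos (α j q) ≠ 0 ∧ Real.sin (α j q) ≠ 0) {c h : StateAction d → ℝ}
    (hh : h - (transProb A α : Matrix _ _ ℝ) *ᵥ h = c - fun _ => stationaryCost A c α)
    (i : S) (p : Fin (d i)) :
    HasDerivAt (costAlong A c α i p) (2 * markedMean (invariantProb (transProb A α))
      (phantomLaw α i p) fun z y => weight α i p z * (h z - h (phantomTarget i p z y)))
      (α i p) := by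
  have : Nonempty (StateAction d) := ⟨⟨i, 0⟩⟩
  refine (hasDerivAt_costAlong hA hα hh i p).congr_deriv ?_
  rw [mul_assoc, mul_assoc, ← mul_assoc (Real.tan _)]
  congr 1
  by_cases hp : p.val + 1 < d i
  · exact (markedMean_weight_of_lt (fun q => (hα i q).2) hp _ h).symm
  · exact (markedMean_weight_of_last (hα i) hp
      (hA.isPositiveStochastic hα).isInvariantProb_invariantProb h).symm

end PhantomDerivative

section MarkedChain

open Matrix

variable {E M Ω : Type*} [MeasurableSpace Ω]

theorem integral_comp_eq_sum {T : Type*} [Fintype T] [MeasurableSpace T]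
    [MeasurableSingletonClass T] {μ : Measure Ω} [IsFiniteMeasure μ] {W : Ω → T}
    (hW : Measurable W) (g : T → ℝ) :
    ∫ ω, g (W ω) ∂μ = ∑ t, μ.real (W ⁻¹' {t}) * g t := by
  have hg : Measurable g := .of_discrete
  rw [← integral_map hW.aemeasurable hg.aestronglyMeasurable, integral_fintype .of_finite]
  simp only [smul_eq_mul, map_measureReal_apply hW (measurableSet_singleton _)]

theorem memLp_comp_of_finite {T : Type*} [Finite T] [MeasurableSpace T]
    [MeasurableSingletonClass T] {μ : Measure Ω} [IsFiniteMeasure μ] {W : Ω → T}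
    (hW : Measurable W) (g : T → ℝ) (q : ENNReal) : MemLp (fun ω => g (W ω)) q μ :=
  (MemLp.of_discrete (f := g) (μ := μ.map W)).comp_of_map hW.aemeasurable

section IntegralOfSeries

variable {ι F : Type*} [Countable ι] [NormedAddCommGroup F] {μ : Measure Ω} {X : ι → Ω → F}

theorem lintegral_tsum_enorm_lt_top (hX : ∀ k, Integrable (X k) μ)
    (hsum : Summable fun k => ∫ ω, ‖X k ω‖ ∂μ) : ∫⁻ ω, ∑' k, ‖X k ω‖ₑ ∂μ < ⊤ := by
  rw [lintegral_tsum fun k => (hX k).1.enorm]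
  simp only [← ofReal_integral_norm_eq_lintegral_enorm (hX _)]
  exact lt_top_iff_ne_top.2 hsum.tsum_ofReal_ne_top

variable [CompleteSpace F]

theorem ae_summable_of_summable_integral_norm (hX : ∀ k, Integrable (X k) μ)
    (hsum : Summable fun k => ∫ ω, ‖X k ω‖ ∂μ) : ∀ᵐ ω ∂μ, Summable fun k => X k ω := by
  filter_upwards [ae_lt_top' (AEMeasurable.tsum fun k => (hX k).1.enorm)
    (lintegral_tsum_enorm_lt_top hX hsum).ne] with ω hω
  exact .of_enorm hω.ne

theorem integrable_tsum_of_summable_integral_norm (hX : ∀ k, Integrable (X k) μ)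
    (hsum : Summable fun k => ∫ ω, ‖X k ω‖ ∂μ) : Integrable (fun ω => ∑' k, X k ω) μ := by
  refine ⟨?_, (lintegral_mono fun ω => enorm_tsum_le_tsum_enorm).trans_lt
    (lintegral_tsum_enorm_lt_top hX hsum)⟩
  refine aestronglyMeasurable_of_tendsto_ae (u := (Filter.atTop : Filter (Finset ι)))
    (f := fun s ω => ∑ k ∈ s, X k ω)
    (fun s => Finset.aestronglyMeasurable_fun_sum s fun k _ => (hX k).1) ?_
  filter_upwards [ae_summable_of_summable_integral_norm hX hsum] with ω hω using hω.hasSum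

end IntegralOfSeries

/-- The event that the chain `Z` does not visit the target `w (Z k) (Y k)` at the times
`k + 1, …, k + m`. -/
def avoids (w : E → M → E) (Z : ℤ → Ω → E) (Y : ℤ → Ω → M) (k : ℤ) (m : ℕ) : Set Ω :=
  {ω | ∀ s ∈ Finset.range m, Z (k + (s + 1)) ω ≠ w (Z k ω) (Y k ω)}

variable [MeasurableSpace E] [MeasurableSpace M]

/-- `Z` is a two-sided stationary Markov chain with transition matrix `P` and marginal `π`, and
each mark `Y k` has law `φ` and is independent of `Z`. -/
structure IsMarkedStationaryChain (P : Matrix E E ℝ) (π : E → ℝ) (φ : M → ℝ) (μ : Measure Ω)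
    (Z : ℤ → Ω → E) (Y : ℤ → Ω → M) : Prop where
  measurable_chain : ∀ k, Measurable (Z k)
  measurable_mark : ∀ k, Measurable (Y k)
  chain_law : ∀ (k : ℤ) (l : ℕ) (z : ℕ → E),
    μ.real {ω | ∀ t ≤ l, Z (k + (t : ℤ)) ω = z t} =
      π (z 0) * ∏ t ∈ Finset.range l, P (z t) (z (t + 1))
  mark_law : ∀ (k : ℤ) (y : M), μ.real {ω | Y k ω = y} = φ y
  indep : ∀ k, IndepFun (fun ω j => Z j ω) (Y k) μ

namespace IsMarkedStationaryChain

variable {P : Matrix E E ℝ} {π : E → ℝ} {φ : M → ℝ} {μ : Measure Ω} {Z : ℤ → Ω → E}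
  {Y : ℤ → Ω → M}

theorem measurable_mark_path (hZ : IsMarkedStationaryChain P π φ μ Z Y) (k : ℤ) (l : ℕ) :
    Measurable fun ω => (Y k ω, fun t : Fin l => Z (k + (t : ℕ)) ω) :=
  (hZ.measurable_mark k).prodMk (measurable_pi_lambda _ fun _ => hZ.measurable_chain _)

theorem measurableSet_avoids [Countable E] [Countable M] [MeasurableSingletonClass E]
    [MeasurableSingletonClass M] (hZ : IsMarkedStationaryChain P π φ μ Z Y) (w : E → M → E)
    (k : ℤ) (m : ℕ) : MeasurableSet (avoids w Z Y k m) := by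
  have hw : Measurable fun ω => w (Z k ω) (Y k ω) :=
    (measurable_of_countable fun q : E × M => w q.1 q.2).comp
      ((hZ.measurable_chain k).prodMk (hZ.measurable_mark k))
  have hInter : avoids w Z Y k m =
      ⋂ s ∈ Finset.range m, {ω | Z (k + (s + 1)) ω = w (Z k ω) (Y k ω)}ᶜ := by
    ext ω
    simp [avoids]
  rw [hInter]
  exact .biInter (Finset.range m).countable_toSet fun s _ =>
    (measurableSet_eq_fun (hZ.measurable_chain _) hw).compl

theorem real_path (hZ : IsMarkedStationaryChain P π φ μ Z Y) (k : ℤ) (l : ℕ)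
    (x : Fin (l + 1) → E) :
    μ.real ((fun ω (t : Fin (l + 1)) => Z (k + (t : ℕ)) ω) ⁻¹' {x}) =
      π (x 0) * ∏ t : Fin l, P (x t.castSucc) (x t.succ) := by
  have h := hZ.chain_law k l fun t => x (Fin.ofNat (l + 1) t)
  rw [Finset.prod_range] at h
  simp only [← Nat.lt_succ_iff] at h
  convert h using 2
  · ext ω
    refine funext_iff.trans (Fin.forall_iff.trans (forall₂_congr fun t ht => ?_))
    rw [Fin.ofNat_eq_cast, Fin.natCast_eq_mk ht]
  · rfl
  · refine Finset.prod_congr rfl fun t _ => congrArg₂ P ?_ ?_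
    · exact congrArg x (Fin.ofNat_val_eq_self t.castSucc).symm
    · exact congrArg x (Fin.ofNat_val_eq_self t.succ).symm

variable [MeasurableSingletonClass E] [MeasurableSingletonClass M]

theorem real_mark_path (hZ : IsMarkedStationaryChain P π φ μ Z Y) (k : ℤ) (l : ℕ) (y : M)
    (x : Fin (l + 1) → E) :
    μ.real ((fun ω => (Y k ω, fun t : Fin (l + 1) => Z (k + (t : ℕ)) ω)) ⁻¹' {(y, x)}) =
      φ y * (π (x 0) * ∏ t : Fin l, P (x t.castSucc) (x t.succ)) := by
  have hpath : Measurable fun (z : ℤ → E) (t : Fin (l + 1)) => z (k + (t : ℕ)) :=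
    measurable_pi_lambda _ fun _ => measurable_pi_apply _
  have h := (hZ.indep k).measure_inter_preimage_eq_mul _ _ (hpath (measurableSet_singleton x))
    (measurableSet_singleton y)
  rw [← hZ.real_path k, ← hZ.mark_law k y, mul_comm, measureReal_def, measureReal_def,
    measureReal_def, ← ENNReal.toReal_mul]
  refine congrArg ENNReal.toReal (Eq.trans (congrArg μ ?_) h)
  ext ω
  exact Prod.mk_inj.trans and_comm

variable [Fintype E] [IsFiniteMeasure μ]

theorem integral_markov [Finite M] (hZ : IsMarkedStationaryChain P π φ μ Z Y) (k : ℤ) (l : ℕ)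
    (H : M → (Fin (l + 1) → E) → E → ℝ) :
    ∫ ω, H (Y k ω) (fun t => Z (k + (t : ℕ)) ω) (Z (k + (l + 1)) ω) ∂μ =
      ∫ ω, (P *ᵥ H (Y k ω) (fun t => Z (k + (t : ℕ)) ω)) (Z (k + l) ω) ∂μ := by
  cases nonempty_fintype M
  have hnext := integral_comp_eq_sum (μ := μ) (hZ.measurable_mark_path k (l + 2)) fun q =>
    H q.1 (Fin.init q.2) (q.2 (Fin.last _))
  have hlast := integral_comp_eq_sum (μ := μ) (hZ.measurable_mark_path k (l + 1)) fun q =>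
    (P *ᵥ H q.1 q.2) (q.2 (Fin.last _))
  refine Eq.trans ?_ (hnext.trans (Eq.trans ?_ hlast.symm))
  · simp only [Fin.val_last, Nat.cast_add, Nat.cast_one]
    rfl
  · simp only [Fintype.sum_prod_type, hZ.real_mark_path]
    refine Finset.sum_congr rfl fun y _ => ?_
    rw [← (Fin.snocEquiv fun _ => E).sum_comp, Fintype.sum_prod_type_right]
    refine Finset.sum_congr rfl fun x _ => ?_
    simp only [Fin.snocEquiv, Equiv.coe_fn_mk, Fin.init_snoc, Fin.snoc_last,
      Fin.prod_univ_castSucc, Fin.snoc_castSucc, mulVec, dotProduct, Finset.mul_sum]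
    refine Finset.sum_congr rfl fun z _ => ?_
    rw [← Fin.castSucc_zero, Fin.snoc_castSucc, Fin.succ_last, Fin.snoc_last]
    simp only [Fin.succ_castSucc, Fin.snoc_castSucc]
    ring

theorem integral_indicator_avoids_next [Finite M] (hZ : IsMarkedStationaryChain P π φ μ Z Y)
    (w : E → M → E) (k : ℤ) (m : ℕ) (g : E → M → E → ℝ) :
    ∫ ω, (avoids w Z Y k m).indicator
        (fun ω => g (Z k ω) (Y k ω) (Z (k + (m + 1)) ω)) ω ∂μ =
      ∫ ω, (avoids w Z Y k m).indicator
        (fun ω => (P *ᵥ g (Z k ω) (Y k ω)) (Z (k + m) ω)) ω ∂μ := by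
  classical
  have h := hZ.integral_markov k m fun y x =>
    if ∀ s : Fin m, x s.succ ≠ w (x 0) y then g (x 0) y else 0
  have havoids : ∀ ω, (∀ s : Fin m, Z (k + (s.succ : ℕ)) ω ≠
      w (Z (k + ((0 : Fin (m + 1)) : ℕ)) ω) (Y k ω)) ↔ ω ∈ avoids w Z Y k m := fun ω => by
    simp [avoids, Fin.forall_iff]
  simp only [havoids] at h
  convert h using 3 with ω ω
  · by_cases hω : ω ∈ avoids w Z Y k m <;> simp [hω]
  · by_cases hω : ω ∈ avoids w Z Y k m <;> simp [hω]

variable [Fintype M]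

theorem integral_chain_mark (hZ : IsMarkedStationaryChain P π φ μ Z Y) (k : ℤ)
    (g : E → M → ℝ) : ∫ ω, g (Z k ω) (Y k ω) ∂μ = markedMean π φ g := by
  have h := integral_comp_eq_sum (μ := μ) (hZ.measurable_mark_path k 1) fun q => g (q.2 0) q.1
  simp only [Fin.val_zero, Nat.cast_zero, add_zero, Fintype.sum_prod_type, hZ.real_mark_path k 0,
    Fin.prod_univ_zero, mul_one] at h
  rw [h, markedMean, Finset.sum_comm]
  refine Fintype.sum_equiv (Equiv.funUnique (Fin 1) E) _ _ fun x =>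
    Finset.sum_congr rfl fun y _ => ?_
  rw [mul_comm (φ y)]
  rfl

theorem integral_indicator_avoids [DecidableEq E] (hZ : IsMarkedStationaryChain P π φ μ Z Y)
    (w : E → M → E) (k : ℤ) (m : ℕ) (g : E → M → E → ℝ) :
    ∫ ω, (avoids w Z Y k m).indicator (fun ω => g (Z k ω) (Y k ω) (Z (k + m) ω)) ω ∂μ =
      markedMean π φ fun z y => (taboo P (w z y) ^ m *ᵥ g z y) z := by
  induction m generalizing g with
  | zero =>
    simpa [avoids] using hZ.integral_chain_mark k fun z y => g z y z
  | succ m ih =>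
    have hstep : ∀ ω, (avoids w Z Y k (m + 1)).indicator
        (fun ω => g (Z k ω) (Y k ω) (Z (k + (m + 1 : ℕ)) ω)) ω =
        (avoids w Z Y k m).indicator (fun ω => if Z (k + (m + 1)) ω = w (Z k ω) (Y k ω) then 0
          else g (Z k ω) (Y k ω) (Z (k + (m + 1)) ω)) ω := fun ω => by
      simp only [Set.indicator_apply, avoids, Set.mem_ofPred_eq, Finset.range_add_one,
        Finset.forall_mem_insert, Nat.cast_add, Nat.cast_one]
      split_ifs <;> tauto
    simp only [hstep]
    rw [hZ.integral_indicator_avoids_next w k m fun z y x => if x = w z y then 0 else g z y x]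
    have htaboo : ∀ z y, (P *ᵥ fun x => if x = w z y then 0 else g z y x) =
        taboo P (w z y) *ᵥ g z y := fun z y => funext fun x => by rw [taboo_mulVec_apply]; rfl
    simp only [htaboo, ih fun z y => taboo P (w z y) *ᵥ g z y, pow_succ, mulVec_mulVec]

theorem integral_indicator_avoids_start [DecidableEq E]
    (hZ : IsMarkedStationaryChain P π φ μ Z Y) (w : E → M → E) (K : E → ℝ) (k : ℤ) (m : ℕ) :
    ∫ ω, (avoids w Z Y k m).indicator (fun ω => K (Z k ω)) ω ∂μ =
      markedMean π φ fun z y => K z * (taboo P (w z y) ^ m *ᵥ 1) z := by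
  simpa [mulVec_smul] using hZ.integral_indicator_avoids w k m fun z _ => K z • 1

theorem integral_indicator_avoids_mul [DecidableEq E]
    (hZ : IsMarkedStationaryChain P π φ μ Z Y) (w : E → M → E) (K f : E → ℝ) (k : ℤ) (m : ℕ) :
    ∫ ω, (avoids w Z Y k m).indicator (fun ω => K (Z k ω) * f (Z (k + (m + 1)) ω)) ω ∂μ =
      markedMean π φ fun z y => K z * (taboo P (w z y) ^ m *ᵥ P *ᵥ f) z := by
  have h := hZ.integral_indicator_avoids_next w k m fun z _ => K z • f
  rw [hZ.integral_indicator_avoids w k m fun z _ => P *ᵥ (K z • f)] at h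
  simpa [mulVec_smul] using h

end IsMarkedStationaryChain

end MarkedChain

section HittingTimes

open Filter Matrix

variable {E M Ω : Type*}

/-- The time after `k` at which the chain `Z` first visits the target `w (Z k) (Y k)`; it is `0` if
the target is never visited. -/
noncomputable def firstHit (w : E → M → E) (Z : ℤ → Ω → E) (Y : ℤ → Ω → M) (k : ℤ) (ω : Ω) : ℕ :=
  sInf {m : ℕ | 0 < m ∧ Z (k + m) ω = w (Z k ω) (Y k ω)}

/-- The cost `f (Z j)`, weighted by `K (Z k)`, that the phantom born at time `k` collects at
time `j`: it is counted from time `k + 1` up to the visit to the target. -/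
noncomputable def occupation (w : E → M → E) (Z : ℤ → Ω → E) (Y : ℤ → Ω → M) (K f : E → ℝ)
    (j k : ℤ) (ω : Ω) : ℝ :=
  if k < j ∧ j ≤ k + (firstHit w Z Y k ω : ℤ) then K (Z k ω) * f (Z j ω) else 0

/-- The lifetime, weighted by `K (Z k)`, of the phantom born at time `k` if it dies at time `j`,
and `0` otherwise. -/
noncomputable def lifetimeAt (w : E → M → E) (Z : ℤ → Ω → E) (Y : ℤ → Ω → M) (K : E → ℝ)
    (j k : ℤ) (ω : Ω) : ℝ :=
  if k + (firstHit w Z Y k ω : ℤ) = j then K (Z k ω) * firstHit w Z Y k ω else 0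

/-- The weighted gain of the phantom born at time `k` over the set `B` of times: the costs it
collects minus, if it dies, its lifetime multiplied by the estimate `G` of the mean cost. -/
noncomputable def gain (w : E → M → E) (Z : ℤ → Ω → E) (Y : ℤ → Ω → M) (K f : E → ℝ) (G : Ω → ℝ)
    (B : Finset ℤ) (k : ℤ) (ω : Ω) : ℝ :=
  ∑ j ∈ B, occupation w Z Y K f j k ω - (∑ j ∈ B, lifetimeAt w Z Y K j k ω) * G ω

variable {w : E → M → E} {Z : ℤ → Ω → E} {Y : ℤ → Ω → M} {K f : E → ℝ} {j k : ℤ} {ω : Ω}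

theorem lt_firstHit_iff (hhit : ∃ m : ℕ, 0 < m ∧ Z (k + m) ω = w (Z k ω) (Y k ω)) (m : ℕ) :
    m < firstHit w Z Y k ω ↔ ω ∈ avoids w Z Y k m := by
  refine ⟨fun hm s hs hvisit => ?_, fun havoids => ?_⟩
  · have hle : firstHit w Z Y k ω ≤ s + 1 :=
      Nat.sInf_le ⟨s.succ_pos, by rw [Nat.cast_add, Nat.cast_one]; exact hvisit⟩
    have := Finset.mem_range.1 hs
    omega
  · obtain ⟨hpos, hvisit⟩ : 0 < firstHit w Z Y k ω ∧
        Z (k + firstHit w Z Y k ω) ω = w (Z k ω) (Y k ω) := Nat.sInf_mem hhit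
    by_contra! hle
    obtain ⟨s, hs⟩ := Nat.exists_eq_add_one_of_ne_zero hpos.ne'
    rw [hs, Nat.cast_add, Nat.cast_one] at hvisit
    exact havoids s (Finset.mem_range.2 (by omega)) hvisit

theorem occupation_of_le (hjk : j ≤ k) : occupation w Z Y K f j k ω = 0 :=
  if_neg fun h => h.1.not_ge hjk

theorem lifetimeAt_of_le (hjk : j ≤ k) : lifetimeAt w Z Y K j k ω = 0 :=
  ite_eq_right_iff.2 fun h => by
    rw [show firstHit w Z Y k ω = 0 by omega, Nat.cast_zero, mul_zero]

theorem abs_occupation : |occupation w Z Y K f j k ω| = occupation w Z Y |K| |f| j k ω := by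
  rw [occupation, occupation, apply_ite abs, abs_mul, abs_zero]
  rfl

theorem abs_lifetimeAt : |lifetimeAt w Z Y K j k ω| = lifetimeAt w Z Y |K| j k ω := by
  rw [lifetimeAt, lifetimeAt, apply_ite abs, abs_mul, abs_zero, Nat.abs_cast]
  rfl

theorem occupation_add_succ (hhit : ∃ m : ℕ, 0 < m ∧ Z (k + m) ω = w (Z k ω) (Y k ω)) (m : ℕ) :
    occupation w Z Y K f (k + (m + 1)) k ω =
      (avoids w Z Y k m).indicator (fun ω => K (Z k ω) * f (Z (k + (m + 1)) ω)) ω := by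
  classical
  rw [occupation, Set.indicator_apply]
  exact if_congr (Iff.trans (by omega) (lt_firstHit_iff hhit m)) rfl rfl

theorem lifetimeAt_add_succ (hhit : ∃ m : ℕ, 0 < m ∧ Z (k + m) ω = w (Z k ω) (Y k ω)) (m : ℕ) :
    lifetimeAt w Z Y K (k + (m + 1)) k ω =
      (m + 1) * ((avoids w Z Y k m).indicator (fun ω => K (Z k ω)) ω -
        (avoids w Z Y k (m + 1)).indicator (fun ω => K (Z k ω)) ω) := by
  classical
  simp only [lifetimeAt, Set.indicator_apply, ← lt_firstHit_iff hhit]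
  rcases lt_trichotomy (m + 1) (firstHit w Z Y k ω) with h | h | h
  · rw [if_neg (by omega), if_pos (by omega), if_pos h, sub_self, mul_zero]
  · rw [if_pos (by omega), if_pos (by omega), if_neg (by omega), ← h]
    push_cast
    ring
  · rw [if_neg (by omega), if_neg (by omega), if_neg (by omega), sub_self, mul_zero]

theorem exists_eq_add_succ_of_lt (hkj : k < j) : ∃ m : ℕ, j = k + (m + 1) :=
  ⟨(j - k - 1).toNat, by omega⟩

namespace IsMarkedStationaryChain

variable [MeasurableSpace Ω] [MeasurableSpace E] [MeasurableSpace M] [MeasurableSingletonClass E]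
  [MeasurableSingletonClass M] [Fintype E] {P : Matrix E E ℝ}
  {π : E → ℝ} {φ : M → ℝ} {μ : Measure Ω} {f : E → ℝ} {G : Ω → ℝ} {D : ℝ}

section IsFiniteMeasure

variable [IsFiniteMeasure μ]

theorem ae_exists_hit [Finite M]
    (hZ : IsMarkedStationaryChain P π φ μ Z Y) (hP : IsPositiveStochastic P) (w : E → M → E) :
    ∀ᵐ ω ∂μ, ∀ k, ∃ m : ℕ, 0 < m ∧ Z (k + m) ω = w (Z k ω) (Y k ω) := by
  classical
  cases nonempty_fintype M
  refine ae_all_iff.2 fun k => ?_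
  have havoids : ∀ m, μ.real (avoids w Z Y k m) =
      markedMean π φ fun z y => (taboo P (w z y) ^ m *ᵥ 1) z := fun m => by
    have h := hZ.integral_indicator_avoids_start w 1 k m
    simp only [Pi.one_apply, one_mul] at h
    rw [← h]
    exact (integral_indicator_one (hZ.measurableSet_avoids w k m)).symm
  have hlim := (hasSum_markedMean (π := π) (φ := φ) fun z y =>
    hP.hasSum_meanHittingTime (w z y) z).summable.tendsto_atTop_zero
  simp only [← havoids] at hlim
  have hzero : μ.real {ω | ¬ ∃ m : ℕ, 0 < m ∧ Z (k + m) ω = w (Z k ω) (Y k ω)} ≤ 0 :=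
    ge_of_tendsto' hlim fun m => measureReal_mono fun ω hω s _ hvisit =>
      hω ⟨s + 1, s.succ_pos, by rw [Nat.cast_add, Nat.cast_one]; exact hvisit⟩
  exact (measureReal_eq_zero_iff).1 (hzero.antisymm measureReal_nonneg)

theorem memLp_occupation [Finite M]
    (hZ : IsMarkedStationaryChain P π φ μ Z Y) (hP : IsPositiveStochastic P)
    (w : E → M → E) (K f : E → ℝ) (j k : ℤ) (q : ENNReal) :
    MemLp (occupation w Z Y K f j k) q μ := by
  rcases le_or_gt j k with hjk | hkj
  · exact MemLp.zero.ae_eq (.of_forall fun ω => (occupation_of_le hjk).symm)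
  · obtain ⟨m, rfl⟩ := exists_eq_add_succ_of_lt hkj
    have hKf := memLp_comp_of_finite (μ := μ)
      ((hZ.measurable_chain k).prodMk (hZ.measurable_chain (k + (m + 1))))
      (fun x => K x.1 * f x.2) q
    refine (hKf.indicator (hZ.measurableSet_avoids w k m)).ae_eq ?_
    filter_upwards [hZ.ae_exists_hit hP w] with ω hω using (occupation_add_succ (hω k) m).symm

theorem memLp_lifetimeAt [Finite M]
    (hZ : IsMarkedStationaryChain P π φ μ Z Y) (hP : IsPositiveStochastic P)
    (w : E → M → E) (K : E → ℝ) (j k : ℤ) (q : ENNReal) :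
    MemLp (lifetimeAt w Z Y K j k) q μ := by
  rcases le_or_gt j k with hjk | hkj
  · exact MemLp.zero.ae_eq (.of_forall fun ω => (lifetimeAt_of_le hjk).symm)
  · obtain ⟨m, rfl⟩ := exists_eq_add_succ_of_lt hkj
    have hK := memLp_comp_of_finite (μ := μ) (hZ.measurable_chain k) K q
    refine (((hK.indicator (hZ.measurableSet_avoids w k m)).sub
      (hK.indicator (hZ.measurableSet_avoids w k (m + 1)))).const_mul ((m : ℝ) + 1)).ae_eq ?_
    filter_upwards [hZ.ae_exists_hit hP w] with ω hω using (lifetimeAt_add_succ (hω k) m).symm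

theorem integral_lifetimeAt_add_succ [DecidableEq E] [Fintype M]
    (hZ : IsMarkedStationaryChain P π φ μ Z Y)
    (hP : IsPositiveStochastic P) (w : E → M → E) (K : E → ℝ) (k : ℤ) (m : ℕ) :
    ∫ ω, lifetimeAt w Z Y K (k + (m + 1)) k ω ∂μ =
      markedMean π φ fun z y => K z *
        ((m + 1) * ((taboo P (w z y) ^ m *ᵥ 1) z - (taboo P (w z y) ^ (m + 1) *ᵥ 1) z)) := by
  have hK := (memLp_comp_of_finite (μ := μ) (hZ.measurable_chain k) K 1).integrable le_rfl
  have hlife : lifetimeAt w Z Y K (k + (m + 1)) k =ᵐ[μ] fun ω =>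
      (m + 1) * ((avoids w Z Y k m).indicator (fun ω => K (Z k ω)) ω -
        (avoids w Z Y k (m + 1)).indicator (fun ω => K (Z k ω)) ω) := by
    filter_upwards [hZ.ae_exists_hit hP w] with ω hω using lifetimeAt_add_succ (hω k) m
  rw [integral_congr_ae hlife, integral_const_mul,
    integral_sub (hK.indicator (hZ.measurableSet_avoids w k m))
      (hK.indicator (hZ.measurableSet_avoids w k (m + 1))),
    hZ.integral_indicator_avoids_start, hZ.integral_indicator_avoids_start, ← markedMean_sub,
    ← markedMean_const_mul]
  simp only [← mul_sub, mul_left_comm (K _)]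

theorem integral_occupation_add_succ [DecidableEq E] [Fintype M]
    (hZ : IsMarkedStationaryChain P π φ μ Z Y)
    (hP : IsPositiveStochastic P) (w : E → M → E) (K f : E → ℝ) (k : ℤ) (m : ℕ) :
    ∫ ω, occupation w Z Y K f (k + (m + 1)) k ω ∂μ =
      markedMean π φ fun z y => K z * (taboo P (w z y) ^ m *ᵥ P *ᵥ f) z := by
  rw [← hZ.integral_indicator_avoids_mul w K f k m]
  refine integral_congr_ae ?_
  filter_upwards [hZ.ae_exists_hit hP w] with ω hω using occupation_add_succ (hω k) m

theorem hasSum_integral_occupation [DecidableEq E] [Fintype M]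
    (hZ : IsMarkedStationaryChain P π φ μ Z Y)
    (hP : IsPositiveStochastic P) {f h : E → ℝ} {C : ℝ} (hh : h - P *ᵥ h = f - fun _ => C)
    (w : E → M → E) (K : E → ℝ) (j : ℤ) :
    HasSum (fun k => ∫ ω, occupation w Z Y K f j k ω ∂μ)
      (markedMean π φ fun z y =>
        K z * (meanHittingTime P (w z y) z * C + ((P *ᵥ h) z - (P *ᵥ h) (w z y)))) := by
  refine (hasSum_int_iff_of_eq_zero (j := j) fun k hjk => ?_).2 ?_
  · simp only [occupation_of_le hjk, integral_zero]
  · refine (hasSum_markedMean fun z y =>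
      (hP.hasSum_taboo_pow_mulVec_of_poisson hh (w z y) z).mul_left (K z)).congr_fun fun m => ?_
    rw [← hZ.integral_occupation_add_succ hP w K f (j - (m + 1)), sub_add_cancel]

theorem hasSum_integral_lifetimeAt [DecidableEq E] [Fintype M]
    (hZ : IsMarkedStationaryChain P π φ μ Z Y)
    (hP : IsPositiveStochastic P) (w : E → M → E) (K : E → ℝ) (j : ℤ) :
    HasSum (fun k => ∫ ω, lifetimeAt w Z Y K j k ω ∂μ)
      (markedMean π φ fun z y => K z * meanHittingTime P (w z y) z) := by
  refine (hasSum_int_iff_of_eq_zero (j := j) fun k hjk => ?_).2 ?_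
  · simp only [lifetimeAt_of_le hjk, integral_zero]
  · refine (hasSum_markedMean fun z y =>
      (hP.hasSum_succ_mul_taboo_pow_sub (w z y) z).mul_left (K z)).congr_fun fun m => ?_
    rw [← hZ.integral_lifetimeAt_add_succ hP w K (j - (m + 1)), sub_add_cancel]

theorem summable_integral_abs_occupation [Finite M] (hZ : IsMarkedStationaryChain P π φ μ Z Y)
    (hP : IsPositiveStochastic P) (hπ : IsInvariantProb P π) (w : E → M → E) (K f : E → ℝ)
    (j : ℤ) : Summable fun k => ∫ ω, |occupation w Z Y K f j k ω| ∂μ := by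
  classical
  cases nonempty_fintype M
  obtain ⟨h, hh⟩ := hP.exists_poisson hπ |f|
  simp only [abs_occupation]
  exact (hZ.hasSum_integral_occupation hP hh w |K| j).summable

theorem summable_integral_abs_lifetimeAt [Finite M] (hZ : IsMarkedStationaryChain P π φ μ Z Y)
    (hP : IsPositiveStochastic P) (w : E → M → E) (K : E → ℝ) (j : ℤ) :
    Summable fun k => ∫ ω, |lifetimeAt w Z Y K j k ω| ∂μ := by
  classical
  cases nonempty_fintype M
  simp only [abs_lifetimeAt]
  exact (hZ.hasSum_integral_lifetimeAt hP w |K| j).summable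

-- The phantoms living at time `j` are those that collect the cost `1` at time `j + 1`.
theorem ae_finite_living [Finite M]
    (hZ : IsMarkedStationaryChain P π φ μ Z Y) (hP : IsPositiveStochastic P)
    (hπ : IsInvariantProb P π) (w : E → M → E) (j : ℤ) :
    ∀ᵐ ω ∂μ, {k : ℤ | k ≤ j ∧ j < k + (firstHit w Z Y k ω : ℤ)}.Finite := by
  have hsum := hZ.summable_integral_abs_occupation hP hπ w 1 1 (j + 1)
  have hint : ∀ k, Integrable (occupation w Z Y 1 1 (j + 1) k) μ := fun k =>
    (hZ.memLp_occupation hP w 1 1 (j + 1) k 1).integrable le_rfl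
  filter_upwards [ae_summable_of_summable_integral_norm hint hsum] with ω hω
  have hlt : ∀ᶠ k in cofinite, occupation w Z Y 1 1 (j + 1) k ω < 1 :=
    hω.tendsto_cofinite_zero.eventually_lt_const one_pos
  refine hlt.subset fun k hk => ?_
  have hone : occupation w Z Y 1 1 (j + 1) k ω = 1 :=
    (if_pos (by obtain ⟨h₁, h₂⟩ := hk; omega)).trans (one_mul 1)
  exact hone.not_lt

theorem memLp_sum_lifetimeAt [Finite M] (hZ : IsMarkedStationaryChain P π φ μ Z Y)
    (hP : IsPositiveStochastic P) (w : E → M → E) (K : E → ℝ) (B : Finset ℤ) (k : ℤ)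
    (q : ENNReal) : MemLp (fun ω => ∑ j ∈ B, lifetimeAt w Z Y K j k ω) q μ :=
  memLp_finsetSum _ fun j _ => hZ.memLp_lifetimeAt hP w K j k q

theorem integrable_sum_occupation [Finite M] (hZ : IsMarkedStationaryChain P π φ μ Z Y)
    (hP : IsPositiveStochastic P) (w : E → M → E) (K f : E → ℝ) (B : Finset ℤ) (k : ℤ) :
    Integrable (fun ω => ∑ j ∈ B, occupation w Z Y K f j k ω) μ :=
  integrable_finsetSum _ fun j _ => (hZ.memLp_occupation hP w K f j k 1).integrable le_rfl

theorem integrable_gain [Finite M] (hZ : IsMarkedStationaryChain P π φ μ Z Y)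
    (hP : IsPositiveStochastic P) (hG : AEStronglyMeasurable G μ) (hGD : ∀ᵐ ω ∂μ, ‖G ω‖ ≤ D)
    (w : E → M → E) (K f : E → ℝ) (B : Finset ℤ) (k : ℤ) :
    Integrable (gain w Z Y K f G B k) μ :=
  (hZ.integrable_sum_occupation hP w K f B k).sub
    (((hZ.memLp_sum_lifetimeAt hP w K B k 1).integrable le_rfl).mul_bdd hG hGD)

theorem summable_integral_norm_gain [Finite M] (hZ : IsMarkedStationaryChain P π φ μ Z Y)
    (hP : IsPositiveStochastic P) (hπ : IsInvariantProb P π) (hG : AEStronglyMeasurable G μ)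
    (hGD : ∀ᵐ ω ∂μ, ‖G ω‖ ≤ D) (w : E → M → E) (K f : E → ℝ) (B : Finset ℤ) :
    Summable fun k => ∫ ω, ‖gain w Z Y K f G B k ω‖ ∂μ := by
  have hocc := fun j k => ((hZ.memLp_occupation hP w K f j k 1).integrable le_rfl).abs
  have hlife := fun j k => ((hZ.memLp_lifetimeAt hP w K j k 1).integrable le_rfl).abs
  have hbound : ∀ k, ∫ ω, ‖gain w Z Y K f G B k ω‖ ∂μ ≤
      ∑ j ∈ B, ∫ ω, |occupation w Z Y K f j k ω| ∂μ +
        (∑ j ∈ B, ∫ ω, |lifetimeAt w Z Y K j k ω| ∂μ) * D := fun k => by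
    have hocc_sum := integrable_finsetSum B fun j _ => hocc j k
    have hlife_sum := (integrable_finsetSum B fun j _ => hlife j k).mul_const D
    rw [← integral_finsetSum _ fun j _ => hocc j k, ← integral_finsetSum _ fun j _ => hlife j k,
      ← integral_mul_const, ← integral_add hocc_sum hlife_sum]
    refine integral_mono_ae (hZ.integrable_gain hP hG hGD w K f B k).norm
      (hocc_sum.add hlife_sum) ?_
    filter_upwards [hGD] with ω hω
    refine (norm_sub_le _ _).trans (add_le_add (Finset.abs_sum_le_sum_abs _ _) ?_)
    rw [norm_mul]
    gcongr
    exact Finset.abs_sum_le_sum_abs _ _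
  exact .of_nonneg_of_le (fun k => integral_nonneg fun ω => norm_nonneg _) hbound
    ((summable_sum fun j _ => hZ.summable_integral_abs_occupation hP hπ w K f j).add
      ((summable_sum fun j _ => hZ.summable_integral_abs_lifetimeAt hP w K j).mul_right D))

end IsFiniteMeasure

variable [IsProbabilityMeasure μ]

theorem cov_sum_lifetimeAt [Finite M] (hZ : IsMarkedStationaryChain P π φ μ Z Y)
    (hP : IsPositiveStochastic P) (hG : AEStronglyMeasurable G μ) (hGD : ∀ᵐ ω ∂μ, ‖G ω‖ ≤ D)
    (w : E → M → E) (K f : E → ℝ) (B : Finset ℤ) (k : ℤ) :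
    cov[fun ω => ∑ j ∈ B, lifetimeAt w Z Y K j k ω, G; μ] =
      ∑ j ∈ B, (∫ ω, occupation w Z Y K f j k ω ∂μ -
        (∫ ω, lifetimeAt w Z Y K j k ω ∂μ) * ∫ ω, G ω ∂μ) -
      ∫ ω, gain w Z Y K f G B k ω ∂μ := by
  rw [covariance_eq_sub (hZ.memLp_sum_lifetimeAt hP w K B k 2) (.of_bound hG D hGD),
    integral_finsetSum _ fun j _ => (hZ.memLp_lifetimeAt hP w K j k 1).integrable le_rfl,
    Finset.sum_sub_distrib, ← Finset.sum_mul, sub_right_comm]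
  congr 1
  rw [← integral_finsetSum _ fun j _ => (hZ.memLp_occupation hP w K f j k 1).integrable le_rfl,
    ← integral_sub (hZ.integrable_sum_occupation hP w K f B k)
      (hZ.integrable_gain hP hG hGD w K f B k)]
  simp only [gain, sub_sub_cancel, Pi.mul_apply]

theorem hasSum_cov_sum_lifetimeAt [Fintype M]
    (hZ : IsMarkedStationaryChain P π φ μ Z Y) (hP : IsPositiveStochastic P)
    (hπ : IsInvariantProb P π) (hG : AEStronglyMeasurable G μ) (hGD : ∀ᵐ ω ∂μ, ‖G ω‖ ≤ D)
    {h : E → ℝ} (hh : h - P *ᵥ h = f - fun _ => ∫ ω, G ω ∂μ)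
    (w : E → M → E) (K : E → ℝ) (B : Finset ℤ) :
    HasSum (fun k => cov[fun ω => ∑ j ∈ B, lifetimeAt w Z Y K j k ω, G; μ])
      (B.card * (markedMean π φ fun z y => K z * ((P *ᵥ h) z - (P *ᵥ h) (w z y))) -
        ∫ ω, ∑' k, gain w Z Y K f G B k ω ∂μ) := by
  classical
  have hcentred : ∀ j, HasSum (fun k => ∫ ω, occupation w Z Y K f j k ω ∂μ -
      (∫ ω, lifetimeAt w Z Y K j k ω ∂μ) * ∫ ω, G ω ∂μ)
      (markedMean π φ fun z y => K z * ((P *ᵥ h) z - (P *ᵥ h) (w z y))) := fun j => by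
    have hmean : (markedMean π φ fun z y => K z * ((P *ᵥ h) z - (P *ᵥ h) (w z y))) =
        (markedMean π φ fun z y => K z * (meanHittingTime P (w z y) z * (∫ ω, G ω ∂μ) +
          ((P *ᵥ h) z - (P *ᵥ h) (w z y)))) -
        (markedMean π φ fun z y => K z * meanHittingTime P (w z y) z) * ∫ ω, G ω ∂μ := by
      rw [mul_comm _ (∫ ω, G ω ∂μ), ← markedMean_const_mul, ← markedMean_sub]
      refine congrArg _ (funext₂ fun z y => ?_)
      ring
    rw [hmean]
    exact (hZ.hasSum_integral_occupation hP hh w K j).sub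
      ((hZ.hasSum_integral_lifetimeAt hP w K j).mul_right _)
  have hsum := hasSum_sum (s := B) fun j _ => hcentred j
  rw [Finset.sum_const, nsmul_eq_mul] at hsum
  refine (hsum.sub (hasSum_integral_of_summable_integral_norm
    (hZ.integrable_gain hP hG hGD w K f B)
    (hZ.summable_integral_norm_gain hP hπ hG hGD w K f B))).congr_fun fun k => ?_
  exact hZ.cov_sum_lifetimeAt hP hG hGD w K f B k

end IsMarkedStationaryChain

end HittingTimes

section Batch

variable {S : Type*} {d : S → ℕ}

instance discreteMeasurableSpace_stateAction : DiscreteMeasurableSpace (StateAction d) where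
  forall_measurableSet s := MeasurableSpace.measurableSet_iInf.2 fun i =>
    (.of_discrete : MeasurableSet (Sigma.mk i ⁻¹' s))

theorem card_batch (N : ℕ) (n : ℤ) : (batch N n).card = N := by
  rw [batch, Int.card_Icc, show (n + 1) * (N : ℤ) + 1 - (n * N + 1) = N by ring, Int.toNat_natCast]

variable {Ω : Type*} {i : S} {p : Fin (d i)} {N : ℕ} {Γ : (Fin N → StateAction d) → ℝ} {n : ℤ}
  {Z : ℤ → Ω → StateAction d}

theorem measurable_batchCostEstimator [Finite S] [MeasurableSpace Ω] (hZ : ∀ k, Measurable (Z k))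
    (Γ : (Fin N → StateAction d) → ℝ) (n : ℤ) : Measurable (batchCostEstimator Γ n Z) :=
  (Measurable.of_discrete (f := Γ)).comp (measurable_pi_lambda _ fun _ => hZ _)

theorem exists_norm_batchCostEstimator_le [Finite S] (Γ : (Fin N → StateAction d) → ℝ) (n : ℤ)
    (Z : ℤ → Ω → StateAction d) : ∃ D, ∀ ω, ‖batchCostEstimator Γ n Z ω‖ ≤ D := by
  obtain ⟨D, hD⟩ := (Set.finite_range fun x => ‖Γ x‖).bddAbove
  exact ⟨D, fun ω => hD (Set.mem_range_self _)⟩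

variable {Y : ℤ → Ω → Fin (d i + 1)} {k : ℤ} {ω : Ω}

theorem gain_eq_zero (hk : k ∉ batch N n) (hlive : k ∉ livingPhantoms i p Z Y (n * N) ω)
    (K f : StateAction d → ℝ) (G : Ω → ℝ) :
    gain (phantomTarget i p) Z Y K f G (batch N n) k ω = 0 := by
  have hdead : ¬ (k ≤ n * N ∧ n * N < k + (firstHit (phantomTarget i p) Z Y k ω : ℤ)) := hlive
  simp only [batch, Finset.mem_Icc] at hk
  rw [gain, Finset.sum_eq_zero, Finset.sum_eq_zero, zero_mul, sub_zero]
  · intro j hj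
    simp only [batch, Finset.mem_Icc] at hj
    rcases le_or_gt j k with hjk | hkj
    · exact lifetimeAt_of_le hjk
    · exact if_neg (by omega)
  · intro j hj
    simp only [batch, Finset.mem_Icc] at hj
    exact if_neg (by omega)

variable [DecidableEq S] {α : Angles d} {c : StateAction d → ℝ}

theorem sum_batch_lifetimeAt :
    ∑ j ∈ batch N n, lifetimeAt (phantomTarget i p) Z Y (weight α i p) j k ω =
      weight α i p (Z k ω) * (if k + (hittingTime i p Z Y k ω : ℤ) ∈ batch N n
        then (hittingTime i p Z Y k ω : ℝ) else 0) := by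
  rw [mul_ite, mul_zero]
  exact Finset.sum_ite_eq _ _ _

theorem weight_mul_phantomGain {s : ℤ} (hs : s = max k (n * N) + 1) :
    weight α i p (Z k ω) * phantomGain c i p Γ n Z Y k s ω =
      gain (phantomTarget i p) Z Y (weight α i p) c (batchCostEstimator Γ n Z) (batch N n) k ω := by
  have hocc : ∑ j ∈ batch N n, occupation (phantomTarget i p) Z Y (weight α i p) c j k ω =
      weight α i p (Z k ω) *
        ∑ j ∈ Finset.Icc s (min (k + (hittingTime i p Z Y k ω : ℤ)) ((n + 1) * N)), c (Z j ω) := by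
    simp only [occupation]
    rw [← Finset.sum_filter, Finset.mul_sum]
    refine Finset.sum_congr (Finset.ext fun j => ?_) fun _ _ => rfl
    simp only [batch, Finset.mem_Icc, Finset.mem_filter, hs]
    change _ ↔ _ ∧ j ≤ min (k + (firstHit (phantomTarget i p) Z Y k ω : ℤ)) _
    omega
  rw [gain, hocc, sum_batch_lifetimeAt, phantomGain, mul_sub]
  split_ifs <;> ring

theorem hasSum_gain (hlive : (livingPhantoms i p Z Y (n * N) ω).Finite) :
    HasSum (fun k => gain (phantomTarget i p) Z Y (weight α i p) c (batchCostEstimator Γ n Z)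
        (batch N n) k ω)
      (∑ k ∈ batch N n, weight α i p (Z k ω) * phantomGain c i p Γ n Z Y k (k + 1) ω +
        ∑' k : livingPhantoms i p Z Y (n * N) ω, weight α i p (Z k ω) *
          phantomGain c i p Γ n Z Y k (n * N + 1) ω) := by
  have hbatch : ∀ k ∈ batch N n, n * N < k := fun k hk => by
    simp only [batch, Finset.mem_Icc] at hk
    omega
  have hdisj : Disjoint (batch N n : Set ℤ) (livingPhantoms i p Z Y (n * N) ω) :=
    Set.disjoint_left.2 fun k hk hk' => (hbatch k hk).not_ge hk'.1
  have : Finite (livingPhantoms i p Z Y (n * N) ω) := hlive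
  rw [Finset.sum_congr rfl fun k hk =>
      weight_mul_phantomGain (by rw [max_eq_left (hbatch k hk).le]),
    tsum_congr fun k : livingPhantoms i p Z Y (n * N) ω =>
      weight_mul_phantomGain (by rw [max_eq_right k.2.1])]
  refine (hasSum_subtype_iff_of_support_subset fun k hk => ?_).1
    (HasSum.add_disjoint hdisj ((batch N n).hasSum _) Summable.of_finite.hasSum)
  by_contra hmem
  rw [Set.mem_union, not_or] at hmem
  exact hk (gain_eq_zero hmem.1 hmem.2 _ _ _)

theorem fastPhantomEstimator_eq (hlive : (livingPhantoms i p Z Y (n * N) ω).Finite) :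
    fastPhantomEstimator c α i p Γ n Z Y ω = 2 / (N : ℝ) *
      (∑ k ∈ batch N n, weight α i p (Z k ω) *
        (c (Z k ω) - c (phantomTarget i p (Z k ω) (Y k ω))) +
      ∑' k, gain (phantomTarget i p) Z Y (weight α i p) c (batchCostEstimator Γ n Z)
        (batch N n) k ω) := by
  rw [(hasSum_gain hlive).tsum_eq, fastPhantomEstimator, ← add_assoc, ← Finset.sum_add_distrib]
  simp only [← mul_add]
  rfl

end Batch

section Estimator

open Matrix

variable {S : Type*} {d : S → ℕ} {α : Angles d} {i : S} {p : Fin (d i)}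
  {Ω : Type*} [MeasurableSpace Ω] {μ : Measure Ω} {Z : ℤ → Ω → StateAction d}
  {Y : ℤ → Ω → Fin (d i + 1)}

theorem IsStationaryPhantomSystem.isMarkedStationaryChain [Fintype S]
    {A : (i : S) → Fin (d i + 1) → S → ℝ} (hZY : IsStationaryPhantomSystem A α i p μ Z Y) :
    IsMarkedStationaryChain (transProb A α) (invariantProb (transProb A α)) (phantomLaw α i p)
      μ Z Y where
  measurable_chain := hZY.measurable_chain
  measurable_mark := hZY.measurable_phantom
  chain_law := hZY.chain_law
  mark_law := hZY.phantom_law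
  indep k := hZY.chain_indep_phantom.comp measurable_id (measurable_pi_apply k)

variable [DecidableEq S] {c : StateAction d → ℝ} {N : ℕ} {Γ : (Fin N → StateAction d) → ℝ} {n : ℤ}
  {P : Matrix (StateAction d) (StateAction d) ℝ} {π : StateAction d → ℝ} {φ : Fin (d i + 1) → ℝ}

namespace IsMarkedStationaryChain

section IsFiniteMeasure

variable [IsFiniteMeasure μ]

theorem integrable_start [Finite S] (hZ : IsMarkedStationaryChain P π φ μ Z Y) (k : ℤ) :
    Integrable (fun ω => weight α i p (Z k ω) *
      (c (Z k ω) - c (phantomTarget i p (Z k ω) (Y k ω)))) μ :=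
  (memLp_comp_of_finite ((hZ.measurable_chain k).prodMk (hZ.measurable_mark k))
    (fun q => weight α i p q.1 * (c q.1 - c (phantomTarget i p q.1 q.2))) 1).integrable le_rfl

variable [Fintype S]

theorem fastPhantomEstimator_ae_eq (hZ : IsMarkedStationaryChain P π φ μ Z Y)
    (hP : IsPositiveStochastic P) (hπ : IsInvariantProb P π) :
    fastPhantomEstimator c α i p Γ n Z Y =ᵐ[μ] fun ω => 2 / (N : ℝ) *
      (∑ k ∈ batch N n, weight α i p (Z k ω) *
        (c (Z k ω) - c (phantomTarget i p (Z k ω) (Y k ω))) +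
      ∑' k, gain (phantomTarget i p) Z Y (weight α i p) c (batchCostEstimator Γ n Z)
        (batch N n) k ω) := by
  filter_upwards [hZ.ae_finite_living hP hπ (phantomTarget i p) (n * N)] with ω hω
  exact fastPhantomEstimator_eq hω

theorem integrable_tsum_gain (hZ : IsMarkedStationaryChain P π φ μ Z Y)
    (hP : IsPositiveStochastic P) (hπ : IsInvariantProb P π) :
    Integrable (fun ω => ∑' k, gain (phantomTarget i p) Z Y (weight α i p) c
      (batchCostEstimator Γ n Z) (batch N n) k ω) μ := by
  obtain ⟨D, hD⟩ := exists_norm_batchCostEstimator_le Γ n Z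
  have hΓ := (measurable_batchCostEstimator hZ.measurable_chain Γ n).aestronglyMeasurable (μ := μ)
  exact integrable_tsum_of_summable_integral_norm
    (hZ.integrable_gain hP hΓ (.of_forall hD) _ _ _ _)
    (hZ.summable_integral_norm_gain hP hπ hΓ (.of_forall hD) _ _ _ _)

theorem integrable_fastPhantomEstimator (hZ : IsMarkedStationaryChain P π φ μ Z Y)
    (hP : IsPositiveStochastic P) (hπ : IsInvariantProb P π) :
    Integrable (fastPhantomEstimator c α i p Γ n Z Y) μ :=
  (((integrable_finsetSum _ fun k _ => hZ.integrable_start k).add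
    (hZ.integrable_tsum_gain hP hπ)).const_mul _).congr (hZ.fastPhantomEstimator_ae_eq hP hπ).symm

theorem integral_fastPhantomEstimator (hZ : IsMarkedStationaryChain P π φ μ Z Y)
    (hP : IsPositiveStochastic P) (hπ : IsInvariantProb P π) :
    ∫ ω, fastPhantomEstimator c α i p Γ n Z Y ω ∂μ = 2 / (N : ℝ) *
      (N * (markedMean π φ fun z y => weight α i p z * (c z - c (phantomTarget i p z y))) +
        ∫ ω, ∑' k, gain (phantomTarget i p) Z Y (weight α i p) c (batchCostEstimator Γ n Z)
          (batch N n) k ω ∂μ) := by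
  rw [integral_congr_ae (hZ.fastPhantomEstimator_ae_eq hP hπ), integral_const_mul,
    integral_add (integrable_finsetSum _ fun k _ => hZ.integrable_start k)
      (hZ.integrable_tsum_gain hP hπ), integral_finsetSum _ fun k _ => hZ.integrable_start k]
  simp only [hZ.integral_chain_mark _ fun z y => weight α i p z * (c z - c (phantomTarget i p z y)),
    Finset.sum_const, card_batch, nsmul_eq_mul]

end IsFiniteMeasure

theorem hasSum_bias_fastPhantomEstimator [Fintype S] [IsProbabilityMeasure μ]
    (hZ : IsMarkedStationaryChain P π φ μ Z Y) (hP : IsPositiveStochastic P)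
    (hπ : IsInvariantProb P π) {h : StateAction d → ℝ}
    (hh : h - P *ᵥ h = c - fun _ => ∫ ω, batchCostEstimator Γ n Z ω ∂μ) (hN : 1 ≤ N) :
    HasSum (fun k : ℤ => -(2 / (N : ℝ)) *
        cov[fun ω => weight α i p (Z k ω) * (if k + (hittingTime i p Z Y k ω : ℤ) ∈ batch N n
              then (hittingTime i p Z Y k ω : ℝ) else 0), batchCostEstimator Γ n Z; μ])
      (∫ ω, fastPhantomEstimator c α i p Γ n Z Y ω ∂μ -
        2 * markedMean π φ fun z y => weight α i p z * (h z - h (phantomTarget i p z y))) := by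
  obtain ⟨D, hD⟩ := exists_norm_batchCostEstimator_le Γ n Z
  have hcov := hZ.hasSum_cov_sum_lifetimeAt hP hπ
    (measurable_batchCostEstimator hZ.measurable_chain Γ n).aestronglyMeasurable
    (.of_forall hD) hh (phantomTarget i p) (weight α i p) (batch N n)
  simp only [sum_batch_lifetimeAt, card_batch] at hcov
  have hpoisson : ∀ z, h z = c z - (∫ ω, batchCostEstimator Γ n Z ω ∂μ) + (P *ᵥ h) z := fun z =>
    eq_add_of_sub_eq (congrFun hh z)
  have hsplit : (markedMean π φ fun z y => weight α i p z * (h z - h (phantomTarget i p z y))) =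
      (markedMean π φ fun z y => weight α i p z * (c z - c (phantomTarget i p z y))) +
        markedMean π φ fun z y =>
          weight α i p z * ((P *ᵥ h) z - (P *ᵥ h) (phantomTarget i p z y)) := by
    rw [← markedMean_add]
    refine congrArg _ (funext₂ fun z y => ?_)
    rw [hpoisson z, hpoisson (phantomTarget i p z y)]
    ring
  have hN₀ : (N : ℝ) ≠ 0 := Nat.cast_ne_zero.2 (by omega)
  rw [hZ.integral_fastPhantomEstimator hP hπ, hsplit]
  have hbias : ∀ R V I : ℝ, 2 / (N : ℝ) * (N * R + I) - 2 * (R + V) =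
      -(2 / (N : ℝ)) * (N * V - I) := fun R V I => by
    field_simp
    ring
  rw [hbias]
  exact hcov.mul_left _

end IsMarkedStationaryChain

end Estimator

theorem cos_and_sin_ne_zero {x : ℝ} (hx : x ∈ Set.Ioo 0 (Real.pi / 2)) :
    Real.cos x ≠ 0 ∧ Real.sin x ≠ 0 :=
  ⟨(Real.cos_pos_of_mem_Ioo ⟨by linarith [hx.1, Real.pi_pos], hx.2⟩).ne',
    (Real.sin_pos_of_pos_of_lt_pi hx.1 (by linarith [hx.2, Real.pi_pos])).ne'⟩

end PhantomMDP

open PhantomMDP in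
theorem mainTheorem4_general {S : Type*} [Fintype S] [DecidableEq S] {d : S → ℕ}
    {A : (i : S) → Fin (d i + 1) → S → ℝ} (hA : IsPositiveControlledLaw A)
    (c : StateAction d → ℝ)
    {α : Angles d} (hα : ∀ j q, Real.cos (α j q) ≠ 0 ∧ Real.sin (α j q) ≠ 0)
    {i : S} {p : Fin (d i)}
    {Ω : Type*} [MeasurableSpace Ω] {μ : Measure Ω} [IsProbabilityMeasure μ]
    {Z : ℤ → Ω → StateAction d} {Y : ℤ → Ω → Fin (d i + 1)}
    (hZY : IsMarkedStationaryChain (transProb A α) (invariantProb (transProb A α))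
      (phantomLaw α i p) μ Z Y)
    {N : ℕ} (hN : 1 ≤ N) (n : ℤ)
    (Γ : (Fin N → StateAction d) → ℝ)
    (hΓ : ∫ ω, batchCostEstimator Γ n Z ω ∂μ = stationaryCost A c α) :
    (∀ᵐ ω ∂μ,
      (∀ k : ℤ, ∃ m : ℕ, 0 < m ∧
        Z (k + (m : ℤ)) ω = ⟨i, phantomAction i p Z Y k ω⟩) ∧
      (livingPhantoms i p Z Y (n * N) ω).Finite) ∧
    Integrable (fastPhantomEstimator c α i p Γ n Z Y) μ ∧
    DifferentiableAt ℝ (costAlong A c α i p) (α i p) ∧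
    HasSum
      (fun k : ℤ => -(2 / (N : ℝ)) *
        cov[fun ω => weight α i p (Z k ω) *
              (if k + (hittingTime i p Z Y k ω : ℤ) ∈ batch N n
                then (hittingTime i p Z Y k ω : ℝ) else 0),
            batchCostEstimator Γ n Z; μ])
      (∫ ω, fastPhantomEstimator c α i p Γ n Z Y ω ∂μ -
        deriv (costAlong A c α i p) (α i p)) := by
  have : Nonempty (StateAction d) := ⟨⟨i, 0⟩⟩
  have hP := hA.isPositiveStochastic hα
  have hπ := hP.isInvariantProb_invariantProb
  obtain ⟨h, hh⟩ := hP.exists_poisson hπ c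
  have hderiv := hasDerivAt_costAlong_markedMean hA hα hh i p
  refine ⟨?_, hZY.integrable_fastPhantomEstimator hP hπ, hderiv.differentiableAt, ?_⟩
  · filter_upwards [hZY.ae_exists_hit hP (phantomTarget i p),
      hZY.ae_finite_living hP hπ (phantomTarget i p) (n * N)] with ω hhit hlive
    exact ⟨hhit, hlive⟩
  · rw [hderiv.deriv]
    exact hZY.hasSum_bias_fastPhantomEstimator hP hπ (hΓ ▸ hh) hN

theorem mainTheorem4 {S : Type*} [Fintype S] [DecidableEq S] (d : S → ℕ)
    (A : (i : S) → Fin (d i + 1) → S → ℝ) (hA : PhantomMDP.IsPositiveControlledLaw A)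
    (c : PhantomMDP.StateAction d → ℝ)
    (α : PhantomMDP.Angles d) (hα : ∀ i p, α i p ∈ Set.Ioo 0 (Real.pi / 2))
    (i : S) (p : Fin (d i))
    {Ω : Type*} [MeasurableSpace Ω] (μ : Measure Ω) [IsProbabilityMeasure μ]
    (Z : ℤ → Ω → PhantomMDP.StateAction d) (Y : ℤ → Ω → Fin (d i + 1))
    (hZY : PhantomMDP.IsStationaryPhantomSystem A α i p μ Z Y)
    (N : ℕ) (hN : 1 ≤ N) (n : ℤ)
    (Γ : (Fin N → PhantomMDP.StateAction d) → ℝ)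
    (hΓ : ∫ ω, PhantomMDP.batchCostEstimator Γ n Z ω ∂μ = PhantomMDP.stationaryCost A c α) :
    -- almost surely all phantoms die, and finitely many are living at the start of the batch
    (∀ᵐ ω ∂μ,
      (∀ k : ℤ, ∃ m : ℕ, 0 < m ∧
        Z (k + (m : ℤ)) ω = ⟨i, PhantomMDP.phantomAction i p Z Y k ω⟩) ∧
      (PhantomMDP.livingPhantoms i p Z Y (n * N) ω).Finite) ∧
    Integrable (PhantomMDP.fastPhantomEstimator c α i p Γ n Z Y) μ ∧
    DifferentiableAt ℝ (PhantomMDP.costAlong A c α i p) (α i p) ∧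
    -- the bias
    HasSum
      (fun k : ℤ => -(2 / (N : ℝ)) *
        cov[fun ω => PhantomMDP.weight α i p (Z k ω) *
              (if k + (PhantomMDP.hittingTime i p Z Y k ω : ℤ) ∈ PhantomMDP.batch N n
                then (PhantomMDP.hittingTime i p Z Y k ω : ℝ) else 0),
            PhantomMDP.batchCostEstimator Γ n Z; μ])
      (∫ ω, PhantomMDP.fastPhantomEstimator c α i p Γ n Z Y ω ∂μ -
        deriv (PhantomMDP.costAlong A c α i p) (α i p)) :=
  mainTheorem4_general hA c (fun j q => PhantomMDP.cos_and_sin_ne_zero (hα j q))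
    hZY.isMarkedStationaryChain hN n Γ hΓ
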